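/- Let $\xi$ and $\eta$ be random vectors with values in $\mathbb R^p$ and $\mathbb R^q$ such that $(\xi,\eta)$ is Gaussian, the covariance matrices $R_\xi$ and $R_\eta$ are nonsingular, and the joint law $P_{\xi\eta}$ is absolutely continuous with respect to $P_\xi\otimes P_\eta$. Let $R_{\xi\eta}$ be the cross-covariance matrix, assume that $r=\operatorname{rank}(R_{\xi\eta})\ge 1$, and let $\rho_1\ge\rho_2\ge\dots\ge\rho_r>0$ be the positive canonical correlations of $\xi$ and $\eta$, i.e. the positive singular values of $R_\xi^{-1/2}R_{\xi\eta}R_\eta^{-1/2}$, listed with multiplicity. Let $i(\xi;\eta)=\log\frac{dP_{\xi\eta}}{d(P_\xi\otimes P_\eta)}(\xi,\eta)$ be the information density (natural logarithm) and $I=I(\xi;\eta)=\mathbb E[i(\xi;\eta)]$ the mutual information. Then $i(\xi;\eta)$ is integrable and has a probability density function with respect to Lebesgue measure, which is given by $$f(x)=\frac{1}{\rho_r\sqrt{\pi}}\sum_{k_1=0}^\infty\sum_{k_2=0}^\infty\cdots\sum_{k_{r-1}=0}^\infty\left[\prod_{i=1}^{r-1}\frac{\rho_r}{\rho_i}\,\frac{(2k_i)!}{(k_i!)^2\,4^{k_i}}\left(1-\frac{\rho_r^2}{\rho_i^2}\right)^{k_i}\right]\frac{K_{\frac{r-1}{2}+k_1+\dots+k_{r-1}}\!\left(\left|\frac{x-I}{\rho_r}\right|\right)}{\Gamma\!\left(\frac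 r2+k_1+\dots+k_{r-1}\right)}\left|\frac{x-I}{2\rho_r}\right|^{\frac{r-1}{2}+k_1+\dots+k_{r-1}},\qquad x\in\mathbb R\setminus\{I\},$$ where the series converges absolutely for every $x\ne I$ and $K_\alpha$ denotes the modified Bessel function of the second kind of order $\alpha$. (For $r=1$ the sum consists of a single term with empty product.) If $r\ge 2$, the density is also well defined at $x=I$: every term of the series has a finite limit as $x\to I$, the series of these limits converges absolutely, and $\lim_{x\to I}f(x)$ exists, is finite, and equals $\frac{1}{\rho_r\sqrt\pi}$ times the sum of that series. -/

import Mathlib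

open MeasureTheory ProbabilityTheory Filter Topology

namespace GaussianInfo

open scoped MatrixOrder Nat

/-- The modified Bessel function of the second kind of real order `ν` at a real argument `y > 0`:
`K_ν(y) = ∫_0^∞ exp (-y cosh t) cosh (ν t) dt`. -/
noncomputable def besselK (ν y : ℝ) : ℝ :=
  ∫ t in Set.Ioi (0 : ℝ), Real.exp (-y * Real.cosh t) * Real.cosh (ν * t)

variable {Ω : Type*} [MeasurableSpace Ω] {p q : ℕ}

/-- The information density `i(X;Y) = log (dP_{XY} / d(P_X ⊗ P_Y)) (X, Y)` (natural logarithm),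
a random variable on `Ω`. -/
noncomputable def infoDensity {E F : Type*} [MeasurableSpace E] [MeasurableSpace F]
    (P : Measure Ω) (X : Ω → E) (Y : Ω → F) (ω : Ω) : ℝ :=
  Real.log (((P.map fun ω' => (X ω', Y ω')).rnDeriv ((P.map X).prod (P.map Y))
    (X ω, Y ω)).toReal)

/-- The mutual information `I(X;Y)`, the expectation of the information density. -/
noncomputable def mutualInfo {E F : Type*} [MeasurableSpace E] [MeasurableSpace F]
    (P : Measure Ω) (X : Ω → E) (Y : Ω → F) : ℝ :=
  ∫ ω, infoDensity P X Y ω ∂P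

/-- The cross-covariance matrix `R_{XY}`; the covariance matrix of `X` is `R_{XX}`. -/
noncomputable def covMatrix (P : Measure Ω) (X : Ω → EuclideanSpace ℝ (Fin p))
    (Y : Ω → EuclideanSpace ℝ (Fin q)) : Matrix (Fin p) (Fin q) ℝ :=
  Matrix.of fun i j => cov[fun ω => X ω i, fun ω => Y ω j; P]

/-- The matrix `R_X^{-1/2} R_{XY} R_Y^{-1/2}`. -/
noncomputable def correlationMatrix (P : Measure Ω) (X : Ω → EuclideanSpace ℝ (Fin p))
    (Y : Ω → EuclideanSpace ℝ (Fin q)) : Matrix (Fin p) (Fin q) ℝ :=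
  (CFC.sqrt (covMatrix P X X))⁻¹ * covMatrix P X Y * (CFC.sqrt (covMatrix P Y Y))⁻¹

/-- The canonical correlations of `X` and `Y` in descending order, with multiplicity: the singular
values of `R_X^{-1/2} R_{XY} R_Y^{-1/2}`. The numbering starts at `0`, so `canonicalCorr P X Y i`
is the `(i+1)`-st canonical correlation; the positive ones are those with `i < rank R_{XY}`. -/
noncomputable def canonicalCorr (P : Measure Ω) (X : Ω → EuclideanSpace ℝ (Fin p))
    (Y : Ω → EuclideanSpace ℝ (Fin q)) (i : ℕ) : ℝ :=
  (Matrix.toEuclideanLin (correlationMatrix P X Y)).singularValues i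

/-- The term with multi-index `k = (k_1, …, k_{r-1})` of the series, without the overall factor.
Since `ρ` is numbered from `0`, `ρ (r - 1)` is the last (smallest) of the `r` correlations. -/
noncomputable def pdfTerm (r : ℕ) (ρ : ℕ → ℝ) (I x : ℝ) (k : Fin (r - 1) → ℕ) : ℝ :=
  (∏ i : Fin (r - 1),
      ρ (r - 1) / ρ i * (((2 * k i)! : ℝ) / (((k i)! : ℝ) ^ 2 * 4 ^ k i)) *
        (1 - ρ (r - 1) ^ 2 / ρ i ^ 2) ^ k i) *
    (besselK (((r : ℝ) - 1) / 2 + ∑ i, (k i : ℝ)) |(x - I) / ρ (r - 1)| /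
        Real.Gamma ((r : ℝ) / 2 + ∑ i, (k i : ℝ))) *
    |(x - I) / (2 * ρ (r - 1))| ^ (((r : ℝ) - 1) / 2 + ∑ i, (k i : ℝ))

/-- The `(r-1)`-fold series with the overall factor `1 / (ρ_r √π)`. -/
noncomputable def pdfSeries (r : ℕ) (ρ : ℕ → ℝ) (I x : ℝ) : ℝ :=
  1 / (ρ (r - 1) * √Real.pi) * ∑' k : Fin (r - 1) → ℕ, pdfTerm r ρ I x k

end GaussianInfo

/-! Whiten both vectors and rotate by an orthonormal eigenbasis of the block matrix with
off-diagonal blocks `A` and `Aᵀ`, where `A` is the correlation matrix (`exists_whitening`). The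
product law becomes standard Gaussian and the joint law becomes a product of `N(0, d_j)` with `d_j =
1 + λ_j`. Absolute continuity forces `d_j > 0`, so the information density is an explicit sum of
one-dimensional log densities, quadratic in independent Gaussians. Since `∑ λ_j = 0`, its mean is `I
= -½ ∑ log d_j`, and its moment generating function is `e^{tI} ∏ (1 - t λ_j)^{-1/2}`. The nonzero
`λ_j` are the numbers `±ρ_i`, so this equals `e^{tI} ∏_{i ≤ r} (1 - ρ_i² t²)^{-1/2}`
(`prod_one_sub_mul_eigenvalues_offDiagBlocks`). Re-expanding each factor by the binomial series
around the factor of the smallest correlation gives a nonnegative combination of powers `(1 - ρ_r²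
t²)^{-m}` with `m = r/2 + ∑ k_i` (`tsum_mixWeight_mul`). Such a power, times `e^{tI}`, is the
transform of a Gaussian with Gamma-distributed variance (`lintegral_exp_mul_gammaMixturePDF`), whose
density is a Bessel term of the series (`ofReal_pdfTerm`). Equality of transforms near 0 identifies
the laws (`ext_of_lintegral_exp`). At `x = I` everything follows by domination: for `r ≥ 2` each
term is bounded by its own limit, and these limits are summable. -/

namespace GaussianInfo

/-! ### Integral representation of the Bessel function and a Gamma ratio bound. -/

open scoped MatrixOrder Nat

/-- The integral `∫_0^∞ s^(ν-1) exp (-s - z²/(4s)) ds`, which is `2 |z/2|^ν K_ν(|z|)`. -/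
noncomputable def besselIntegral (ν z : ℝ) : ℝ :=
  ∫ s in Set.Ioi (0 : ℝ), Real.exp (-s - z ^ 2 / (4 * s)) * s ^ (ν - 1)

lemma measurable_besselIntegrand (ν z : ℝ) :
    Measurable fun s : ℝ => Real.exp (-s - z ^ 2 / (4 * s)) * s ^ (ν - 1) := by
  fun_prop

lemma besselIntegrand_le_gammaIntegrand (ν z : ℝ) {s : ℝ} (hs : 0 < s) :
    Real.exp (-s - z ^ 2 / (4 * s)) * s ^ (ν - 1) ≤ Real.exp (-s) * s ^ (ν - 1) := by
  gcongr
  have : 0 ≤ z ^ 2 / (4 * s) := by positivity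
  linarith

lemma integrableOn_besselIntegrand_of_pos {ν : ℝ} (hν : 0 < ν) (z : ℝ) :
    IntegrableOn (fun s : ℝ => Real.exp (-s - z ^ 2 / (4 * s)) * s ^ (ν - 1)) (Set.Ioi 0) := by
  refine (Real.GammaIntegral_convergent hν).mono'
    (measurable_besselIntegrand ν z).aestronglyMeasurable ?_
  filter_upwards [ae_restrict_mem measurableSet_Ioi] with s hs
  have hs : 0 < s := hs
  rw [Real.norm_of_nonneg (by positivity)]
  exact besselIntegrand_le_gammaIntegrand ν z hs

/-- The order `ν = 0`, needed when `r = 1`, has a singularity `1/s` at 0. The bound `exp (-z²/(4s))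
≤ 4s/z²` gains one power of `s`. -/
lemma integrableOn_besselIntegrand {ν z : ℝ} (hν : 0 ≤ ν) (hz : z ≠ 0) :
    IntegrableOn (fun s : ℝ => Real.exp (-s - z ^ 2 / (4 * s)) * s ^ (ν - 1)) (Set.Ioi 0) := by
  refine ((Real.GammaIntegral_convergent (s := ν + 1) (by linarith)).const_mul (4 / z ^ 2)).mono'
    (measurable_besselIntegrand ν z).aestronglyMeasurable ?_
  filter_upwards [ae_restrict_mem measurableSet_Ioi] with s hs
  have hs : 0 < s := hs
  have hz2 : 0 < z ^ 2 := by positivity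
  rw [Real.norm_of_nonneg (by positivity), sub_eq_add_neg, Real.exp_add,
    show ν + 1 - 1 = ν - 1 + 1 by ring, Real.rpow_add_one hs.ne']
  have h1 : Real.exp (-(z ^ 2 / (4 * s))) ≤ 4 * s / z ^ 2 := by
    rw [Real.exp_neg, ← inv_div (z ^ 2)]
    apply inv_anti₀ (by positivity)
    have := Real.add_one_le_exp (z ^ 2 / (4 * s))
    linarith
  calc _ ≤ Real.exp (-s) * (4 * s / z ^ 2) * s ^ (ν - 1) := by gcongr
    _ = _ := by ring

lemma besselIntegral_nonneg (ν z : ℝ) : 0 ≤ besselIntegral ν z :=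
  setIntegral_nonneg measurableSet_Ioi fun s hs => by
    have hs : 0 < s := hs
    positivity

lemma besselIntegral_zero {ν : ℝ} (hν : 0 < ν) : besselIntegral ν 0 = Real.Gamma ν := by
  simp [besselIntegral, Real.Gamma_eq_integral hν]

lemma besselIntegral_le_Gamma {ν : ℝ} (hν : 0 < ν) (z : ℝ) :
    besselIntegral ν z ≤ Real.Gamma ν := by
  rw [Real.Gamma_eq_integral hν]
  exact setIntegral_mono_on (integrableOn_besselIntegrand_of_pos hν z)
    (Real.GammaIntegral_convergent hν) measurableSet_Ioi
    fun s hs => besselIntegrand_le_gammaIntegrand ν z hs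

lemma continuous_besselIntegral {ν : ℝ} (hν : 0 < ν) : Continuous (besselIntegral ν) := by
  refine continuous_of_dominated (bound := fun s => Real.exp (-s) * s ^ (ν - 1))
    (fun z => (measurable_besselIntegrand ν z).aestronglyMeasurable) (fun z => ?_)
    (Real.GammaIntegral_convergent hν) (ae_of_all _ fun s => by fun_prop)
  filter_upwards [ae_restrict_mem measurableSet_Ioi] with s hs
  have hs : 0 < s := hs
  rw [Real.norm_of_nonneg (by positivity)]
  exact besselIntegrand_le_gammaIntegrand ν z hs

/-- The substitution `s = (y/2) e^t`, Jacobian included, turns `s + y²/(4s)` into `y cosh t`. -/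
lemma besselIntegrand_comp_exp (ν : ℝ) {y : ℝ} (hy : 0 < y) (t : ℝ) :
    |y / 2 * Real.exp t| • (Real.exp (-(y / 2 * Real.exp t) - y ^ 2 / (4 * (y / 2 * Real.exp t))) *
      (y / 2 * Real.exp t) ^ (ν - 1)) =
    (y / 2) ^ ν * (Real.exp (-y * Real.cosh t) * Real.exp (ν * t)) := by
  have h0 : 0 < y / 2 * Real.exp t := by positivity
  rw [abs_of_pos h0, smul_eq_mul, Real.rpow_sub_one h0.ne',
    Real.mul_rpow (by positivity) (by positivity), ← Real.exp_mul,
    show -(y / 2 * Real.exp t) - y ^ 2 / (4 * (y / 2 * Real.exp t)) = -y * Real.cosh t by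
      rw [Real.cosh_eq, Real.exp_neg]; field_simp; ring, mul_comm t ν]
  field_simp

lemma image_const_mul_exp_univ {c : ℝ} (hc : 0 < c) :
    (fun t => c * Real.exp t) '' Set.univ = Set.Ioi 0 := by
  ext s
  simp only [Set.image_univ, Set.mem_range, Set.mem_Ioi]
  constructor
  · rintro ⟨t, rfl⟩
    positivity
  · intro hs
    exact ⟨Real.log (s / c), by rw [Real.exp_log (by positivity)]; field_simp⟩

/-- After the substitution the integral of `exp (-y cosh t) exp (ν t)` runs over the whole line;
averaging with `t ↦ -t` replaces `exp (ν t)` by `cosh (ν t)`, which gives `2 K_ν(y)`. -/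
lemma besselK_mul_rpow {ν y : ℝ} (hν : 0 ≤ ν) (hy : 0 < y) :
    besselK ν y * (y / 2) ^ ν = besselIntegral ν y / 2 := by
  have hy2 : 0 < y / 2 := by positivity
  have hderiv : ∀ t ∈ (Set.univ : Set ℝ), HasDerivWithinAt (fun t => y / 2 * Real.exp t)
      (y / 2 * Real.exp t) Set.univ t :=
    fun t _ => ((Real.hasDerivAt_exp t).const_mul _).hasDerivWithinAt
  have hinj : Set.InjOn (fun t => y / 2 * Real.exp t) Set.univ := fun a _ b _ h =>
    Real.exp_injective (mul_left_cancel₀ hy2.ne' h)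
  have hint := (integrableOn_image_iff_integrableOn_abs_deriv_smul MeasurableSet.univ hderiv hinj
    fun s => Real.exp (-s - y ^ 2 / (4 * s)) * s ^ (ν - 1)).1
    (by rw [image_const_mul_exp_univ hy2]; exact integrableOn_besselIntegrand hν hy.ne')
  have hval := integral_image_eq_integral_abs_deriv_smul MeasurableSet.univ hderiv hinj
    fun s => Real.exp (-s - y ^ 2 / (4 * s)) * s ^ (ν - 1)
  rw [image_const_mul_exp_univ hy2] at hval
  simp only [besselIntegrand_comp_exp ν hy] at hint hval
  rw [integrableOn_univ] at hint
  rw [setIntegral_univ, integral_const_mul] at hval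
  have hint' : Integrable fun t => Real.exp (-y * Real.cosh t) * Real.exp (ν * t) := by
    have := hint.const_mul ((y / 2) ^ ν)⁻¹
    have hne : (y / 2) ^ ν ≠ 0 := by positivity
    simpa [inv_mul_cancel_left₀ hne] using this
  have hneg : Integrable fun t => Real.exp (-y * Real.cosh t) * Real.exp (-(ν * t)) := by
    simpa using hint'.comp_neg
  have hflip : ∫ t, Real.exp (-y * Real.cosh t) * Real.exp (-(ν * t)) =
      ∫ t, Real.exp (-y * Real.cosh t) * Real.exp (ν * t) := by
    simpa using integral_neg_eq_self
      (fun t => Real.exp (-y * Real.cosh t) * Real.exp (ν * t)) volume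
  have hcosh : 2 * besselK ν y = ∫ t, Real.exp (-y * Real.cosh t) * Real.exp (ν * t) := by
    have h1 := integral_comp_abs (f := fun t => Real.exp (-y * Real.cosh t) * Real.cosh (ν * t))
    rw [besselK, ← h1]
    have h2 : ∀ t : ℝ, Real.exp (-y * Real.cosh |t|) * Real.cosh (ν * |t|) =
        (Real.exp (-y * Real.cosh t) * Real.exp (ν * t) +
          Real.exp (-y * Real.cosh t) * Real.exp (-(ν * t))) / 2 := by
      intro t
      have h3 : Real.cosh (ν * |t|) = Real.cosh (ν * t) := by
        rw [← Real.cosh_abs, abs_mul, abs_abs, ← abs_mul, Real.cosh_abs]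
      rw [h3, Real.cosh_abs, Real.cosh_eq (ν * t)]
      ring
    simp_rw [h2]
    rw [integral_div, integral_add hint' hneg, hflip]
    ring
  rw [besselIntegral, hval, ← hcosh]
  ring

lemma besselIntegral_abs (ν z : ℝ) : besselIntegral ν |z| = besselIntegral ν z := by
  simp [besselIntegral]

/-- Raising `n` by one multiplies the ratio by `(m - 1/2 + n)/(m + n) ≤ 1`. This bounds the limits
of the terms at `I` by a constant times the weights. -/
lemma Gamma_half_ratio_le {m : ℝ} (hm : 1 ≤ m) (n : ℕ) :
    Real.Gamma (m - 1 / 2 + n) / Real.Gamma (m + n) ≤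
      Real.Gamma (m - 1 / 2) / Real.Gamma m := by
  induction n with
  | zero => simp
  | succ n ih =>
    refine le_trans ?_ ih
    have h1 : 0 < m - 1 / 2 + n := by
      have : (0 : ℝ) ≤ n := by positivity
      linarith
    have h2 : 0 < m + n := by linarith
    have h3 := Real.Gamma_pos_of_pos h1
    have h4 := Real.Gamma_pos_of_pos h2
    push_cast
    rw [← add_assoc, ← add_assoc, Real.Gamma_add_one h1.ne', Real.Gamma_add_one h2.ne',
      mul_div_mul_comm]
    refine mul_le_of_le_one_left (by positivity) ?_
    rw [div_le_one h2]
    linarith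

end GaussianInfo

/-! ### Uniqueness of exponential transforms and product Gaussian densities. -/

namespace GaussianInfo

open scoped MatrixOrder Nat ENNReal NNReal

/-- Finiteness on `(-δ, δ)` makes both complex transforms analytic on the strip `|Re z| < δ`. They
agree on a real interval around 0, hence on the strip, hence on the imaginary axis, where they are
the characteristic functions. -/
lemma ext_of_lintegral_exp {μ ν : Measure ℝ} [IsFiniteMeasure μ] [IsFiniteMeasure ν] {δ : ℝ}
    (hδ : 0 < δ)
    (hfin : ∀ t, |t| < δ → ∫⁻ x, ENNReal.ofReal (Real.exp (t * x)) ∂μ ≠ ∞)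
    (h : ∀ t, |t| < δ → ∫⁻ x, ENNReal.ofReal (Real.exp (t * x)) ∂μ =
      ∫⁻ x, ENNReal.ofReal (Real.exp (t * x)) ∂ν) : μ = ν := by
  have hint : ∀ κ : Measure ℝ,
      (∀ t, |t| < δ → ∫⁻ x, ENNReal.ofReal (Real.exp (t * x)) ∂κ ≠ ∞) →
      Set.Ioo (-δ) δ ⊆ interior (integrableExpSet id κ) := by
    intro κ hκ
    refine interior_maximal (fun t ht => ?_) isOpen_Ioo
    exact (lintegral_ofReal_ne_top_iff_integrable (by fun_prop)
      (ae_of_all _ fun x => (Real.exp_pos _).le)).1 (hκ t (abs_lt.2 ht))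
  have hμ := hint μ hfin
  have hν := hint ν fun t ht => h t ht ▸ hfin t ht
  have hmgf : ∀ t : ℝ, |t| < δ → complexMGF id μ t = complexMGF id ν t := by
    intro t ht
    rw [complexMGF_ofReal, complexMGF_ofReal]
    simp only [mgf, id]
    rw [integral_eq_lintegral_of_nonneg_ae (ae_of_all _ fun x => (Real.exp_pos _).le)
      (by fun_prop), integral_eq_lintegral_of_nonneg_ae
      (ae_of_all _ fun x => (Real.exp_pos _).le) (by fun_prop), h t ht]
  set S : Set ℂ := {z | z.re ∈ Set.Ioo (-δ) δ} with hS
  have hanalytic : ∀ κ : Measure ℝ, Set.Ioo (-δ) δ ⊆ interior (integrableExpSet id κ) →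
      AnalyticOnNhd ℂ (complexMGF id κ) S := fun κ hκ z hz =>
    analyticOnNhd_complexMGF z (hκ hz)
  have hconv : Convex ℝ S := (convex_Ioo (-δ) δ).linear_preimage Complex.reLm
  have heq : Set.EqOn (complexMGF id μ) (complexMGF id ν) S := by
    refine AnalyticOnNhd.eqOn_of_preconnected_of_frequently_eq (hanalytic μ hμ) (hanalytic ν hν)
      hconv.isPreconnected (z₀ := ((0 : ℝ) : ℂ)) (by simp [hS, hδ]) ?_
    have hreal : ∃ᶠ x : ℝ in 𝓝[≠] 0, complexMGF id μ x = complexMGF id ν x := by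
      apply Eventually.frequently
      have : ∀ᶠ x : ℝ in 𝓝 0, |x| < δ :=
        (continuous_abs.tendsto (0 : ℝ)).eventually_lt_const (by simpa using hδ)
      exact (this.filter_mono nhdsWithin_le_nhds).mono hmgf
    rw [frequently_iff_seq_forall] at hreal ⊢
    obtain ⟨xs, hx_tendsto, hx_eq⟩ := hreal
    refine ⟨fun n => xs n, ?_, hx_eq⟩
    rw [tendsto_nhdsWithin_iff] at hx_tendsto ⊢
    refine ⟨(Complex.continuous_ofReal.tendsto 0).comp hx_tendsto.1, ?_⟩
    simpa using hx_tendsto.2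
  refine Measure.ext_of_charFun ?_
  ext t
  rw [← complexMGF_id_mul_I, ← complexMGF_id_mul_I]
  exact heq (by simp [hS, hδ])

lemma lintegral_pi_prod {ι : Type*} [Fintype ι] (μ : ι → Measure ℝ)
    [∀ i, IsProbabilityMeasure (μ i)] (f : ι → ℝ → ℝ≥0∞) (hf : ∀ i, Measurable (f i)) :
    ∫⁻ x, ∏ i, f i (x i) ∂Measure.pi μ = ∏ i, ∫⁻ s, f i s ∂μ i := by
  have hind : iIndepFun (fun i (x : ι → ℝ) => f i (x i)) (Measure.pi μ) :=
    iIndepFun_pi fun i => (hf i).aemeasurable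
  rw [lintegral_prod_eq_prod_lintegral_of_indepFun Finset.univ _ hind
    fun i => (hf i).comp (measurable_pi_apply i)]
  refine Finset.prod_congr rfl fun i _ => ?_
  rw [← (measurePreserving_eval μ i).lintegral_comp (hf i)]

lemma pi_withDensity {ι : Type*} [Fintype ι] (μ ν : ι → Measure ℝ)
    [∀ i, IsProbabilityMeasure (μ i)] [∀ i, SigmaFinite (ν i)] (f : ι → ℝ → ℝ≥0∞)
    (hf : ∀ i, Measurable (f i)) (hν : ∀ i, ν i = (μ i).withDensity (f i)) :
    Measure.pi ν = (Measure.pi μ).withDensity fun x => ∏ i, f i (x i) := by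
  refine Measure.pi_eq fun s hs => ?_
  rw [withDensity_apply _ (MeasurableSet.univ_pi hs),
    ← lintegral_indicator (MeasurableSet.univ_pi hs)]
  have hind : (Set.univ.pi s).indicator (fun x : ι → ℝ => ∏ i, f i (x i)) =
      fun x => ∏ i, (s i).indicator (f i) (x i) := by
    classical
    ext x
    by_cases hx : x ∈ Set.univ.pi s
    · rw [Set.indicator_of_mem hx]
      exact Finset.prod_congr rfl fun i _ => (Set.indicator_of_mem (hx i trivial) _).symm
    · rw [Set.indicator_of_notMem hx]
      simp only [Set.mem_pi, Set.mem_univ, true_implies, not_forall] at hx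
      obtain ⟨i, hi⟩ := hx
      exact (Finset.prod_eq_zero (Finset.mem_univ i) (Set.indicator_of_notMem hi _)).symm
  rw [hind, lintegral_pi_prod μ _ fun i => (hf i).indicator (hs i)]
  refine Finset.prod_congr rfl fun i _ => ?_
  rw [lintegral_indicator (hs i), hν i, withDensity_apply _ (hs i)]

lemma gaussianReal_eq_withDensity {d : ℝ≥0} (hd : d ≠ 0) :
    gaussianReal 0 d = (gaussianReal 0 1).withDensity fun x =>
      ENNReal.ofReal (Real.exp (-(Real.log d / 2) + (1 - 1 / d) * x ^ 2 / 2)) := by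
  rw [gaussianReal_of_var_ne_zero _ hd, gaussianReal_of_var_ne_zero _ one_ne_zero,
    ← withDensity_mul _ (measurable_gaussianPDF _ _) (by fun_prop)]
  congr 1
  ext x
  have hd0 : (0 : ℝ) < d := by exact_mod_cast pos_iff_ne_zero.2 hd
  rw [Pi.mul_apply, gaussianPDF, gaussianPDF, ← ENNReal.ofReal_mul (gaussianPDFReal_nonneg _ _ _),
    gaussianPDFReal, gaussianPDFReal]
  congr 1
  have hsq : Real.exp (-(Real.log d / 2)) = (√d)⁻¹ := by
    rw [Real.exp_neg, ← Real.log_sqrt hd0.le, Real.exp_log (by positivity)]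
  rw [Real.exp_add, hsq, Real.sqrt_mul (by positivity)]
  simp only [sub_zero, NNReal.coe_one, mul_one, mul_inv]
  rw [show ∀ a b c e : ℝ, a * b * (c * e) = a * c * (b * e) by intros; ring, ← Real.exp_add]
  congr 2
  field_simp
  ring

lemma lintegral_exp_sq_gaussianReal {v : ℝ≥0} (hv : v ≠ 0) {c : ℝ} (hc : 2 * c * v < 1) :
    ∫⁻ x, ENNReal.ofReal (Real.exp (c * x ^ 2)) ∂gaussianReal 0 v =
      ENNReal.ofReal (√(1 - 2 * c * v))⁻¹ := by
  have hv0 : (0 : ℝ) < v := by exact_mod_cast pos_iff_ne_zero.2 hv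
  have hpos : 0 < 1 - 2 * c * v := by linarith
  -- The weight `exp (c x²)` turns the Gaussian density of variance `v` into a multiple of the one
  -- with variance `w`, because `1/w = 1/v - 2c`.
  set w : ℝ≥0 := ⟨v / (1 - 2 * c * v), by positivity⟩ with hw
  have hwc : (w : ℝ) = v / (1 - 2 * c * v) := rfl
  have hw0 : w ≠ 0 := by
    have : (0 : ℝ) < w := by rw [hwc]; positivity
    exact_mod_cast this.ne'
  rw [gaussianReal_of_var_ne_zero _ hv, lintegral_withDensity_eq_lintegral_mul _
    (measurable_gaussianPDF _ _) (by fun_prop)]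
  have heq : ∀ x, (gaussianPDF 0 v * fun x => ENNReal.ofReal (Real.exp (c * x ^ 2))) x =
      ENNReal.ofReal (√(1 - 2 * c * v))⁻¹ * gaussianPDF 0 w x := by
    intro x
    rw [Pi.mul_apply, gaussianPDF, gaussianPDF,
      ← ENNReal.ofReal_mul (gaussianPDFReal_nonneg _ _ _), ← ENNReal.ofReal_mul (by positivity),
      gaussianPDFReal, gaussianPDFReal, hwc]
    congr 1
    rw [mul_div_assoc', Real.sqrt_div (by positivity), inv_div, mul_assoc, ← Real.exp_add]
    have : -(x - 0) ^ 2 / (2 * (v : ℝ)) + c * x ^ 2 =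
        -(x - 0) ^ 2 / (2 * (v / (1 - 2 * c * v))) := by
      field_simp
      ring
    rw [this]
    have h1 : √(1 - 2 * c * v) ≠ 0 := by positivity
    have h2 : (√(1 - 2 * c * v))⁻¹ * (√(1 - 2 * c * v) / √(2 * Real.pi * v)) =
        (√(2 * Real.pi * v))⁻¹ := by
      rw [inv_mul_eq_div, div_div_cancel_left' h1]
    rw [← mul_assoc, h2]
  simp_rw [heq]
  rw [lintegral_const_mul _ (measurable_gaussianPDF _ _), lintegral_gaussianPDF_eq_one _ hw0,
    mul_one]

end GaussianInfo

/-! ### Binomial re-expansion and the mixture weights. -/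

namespace GaussianInfo

open scoped MatrixOrder Nat ENNReal NNReal

/-- Both sides are the rising factorial of `1/2` of length `n`, divided by `n!`. -/
lemma choose_half_add_sub_one (n : ℕ) :
    Ring.choose ((1 / 2 : ℝ) + n - 1) n = ((2 * n)! : ℝ) / ((n ! : ℝ) ^ 2 * 4 ^ n) := by
  have hfac : (n ! : ℝ) ≠ 0 := by positivity
  have hasc : ∀ k : ℕ, (ascPochhammer ℝ k).eval (1 / 2) = ((2 * k)! : ℝ) / (k ! * 4 ^ k) := by
    intro k
    induction k with
    | zero => simp
    | succ k ih =>
      rw [ascPochhammer_succ_right, Polynomial.eval_mul, ih, Polynomial.eval_add,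
        Polynomial.eval_X, Polynomial.eval_natCast, show 2 * (k + 1) = 2 * k + 1 + 1 by ring,
        Nat.factorial_succ, Nat.factorial_succ, Nat.factorial_succ]
      push_cast
      field_simp
      ring
  have h := Ring.factorial_nsmul_multichoose_eq_ascPochhammer (1 / 2 : ℝ) n
  rw [Polynomial.ascPochhammer_smeval_eq_eval, hasc, nsmul_eq_mul] at h
  rw [← Ring.multichoose_eq, ← mul_right_inj' hfac, h]
  field_simp

lemma hasSum_inv_sqrt_one_sub {z : ℝ} (hz0 : 0 ≤ z) (hz1 : z < 1) :
    HasSum (fun n : ℕ => ((2 * n)! : ℝ) / ((n ! : ℝ) ^ 2 * 4 ^ n) * z ^ n) (√(1 - z))⁻¹ := by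
  have h := (Real.one_div_one_sub_rpow_hasFPowerSeriesOnBall_zero (1 / 2)).hasSum (y := z)
    (by
      simp only [Metric.mem_eball, edist_zero_right, enorm_eq_nnnorm]
      rwa [← ENNReal.coe_one, ENNReal.coe_lt_coe, ← NNReal.coe_lt_coe, coe_nnnorm,
        Real.norm_of_nonneg hz0])
  simp only [FormalMultilinearSeries.ofScalars_apply_eq, zero_add, choose_half_add_sub_one,
    smul_eq_mul] at h
  rwa [← Real.sqrt_eq_rpow, one_div] at h

lemma tsum_pi_prod {n : ℕ} (f : Fin n → ℕ → ℝ≥0∞) :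
    ∑' k : Fin n → ℕ, ∏ i, f i (k i) = ∏ i, ∑' j, f i j := by
  induction n with
  | zero => simp [tsum_fintype]
  | succ n ih =>
    rw [← (Fin.consEquiv fun _ : Fin (n + 1) => ℕ).tsum_eq, Fin.prod_univ_succ, ← ih]
    simp only [Fin.consEquiv, Equiv.coe_fn_mk, Fin.prod_univ_succ, Fin.cons_zero, Fin.cons_succ]
    rw [ENNReal.tsum_prod (f := fun a (b : Fin n → ℕ) => f 0 a * ∏ i : Fin n, f i.succ (b i))]
    simp_rw [ENNReal.tsum_mul_left, ENNReal.tsum_mul_right]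

/-- With `z = (1 - a²/b²)/(1 - a²t²)` one has `1 - z = (a/b)² (1 - b²t²)/(1 - a²t²)`, so the series
for `(1 - z)^{-1/2}` trades the factor of `b` for powers of the factor of `a`. The condition `a ≤ b`
makes every term nonnegative. -/
lemma tsum_factor {a b t : ℝ} (ha : 0 < a) (hab : a ≤ b) (ht : b ^ 2 * t ^ 2 < 1) :
    ∑' n : ℕ, ENNReal.ofReal (a / b * (((2 * n)! : ℝ) / ((n ! : ℝ) ^ 2 * 4 ^ n)) *
      (1 - a ^ 2 / b ^ 2) ^ n) * ENNReal.ofReal ((1 / (1 - a ^ 2 * t ^ 2)) ^ n) =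
    ENNReal.ofReal (√(1 - a ^ 2 * t ^ 2) * (√(1 - b ^ 2 * t ^ 2))⁻¹) := by
  have hb : 0 < b := ha.trans_le hab
  have hab2 : a ^ 2 ≤ b ^ 2 := by gcongr
  have hu : 0 < 1 - a ^ 2 * t ^ 2 := by nlinarith [sq_nonneg t]
  have hz : 0 ≤ 1 - a ^ 2 / b ^ 2 := by
    rw [sub_nonneg, div_le_one (by positivity)]
    exact hab2
  have hid : 1 - (1 - a ^ 2 / b ^ 2) * (1 / (1 - a ^ 2 * t ^ 2)) =
      (a / b) ^ 2 * (1 - b ^ 2 * t ^ 2) / (1 - a ^ 2 * t ^ 2) := by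
    field_simp
    ring
  have hbt : 0 < 1 - b ^ 2 * t ^ 2 := by linarith
  have hz1 : (1 - a ^ 2 / b ^ 2) * (1 / (1 - a ^ 2 * t ^ 2)) < 1 := by
    rw [← sub_pos, hid]
    positivity
  have hs := (hasSum_inv_sqrt_one_sub (by positivity) hz1).mul_left (a / b)
  have hval : a / b * (√(1 - (1 - a ^ 2 / b ^ 2) * (1 / (1 - a ^ 2 * t ^ 2))))⁻¹ =
      √(1 - a ^ 2 * t ^ 2) * (√(1 - b ^ 2 * t ^ 2))⁻¹ := by
    rw [hid, Real.sqrt_div (by positivity), Real.sqrt_mul (by positivity),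
      Real.sqrt_sq (by positivity)]
    field_simp
  rw [hval] at hs
  rw [← hs.tsum_eq, ENNReal.ofReal_tsum_of_nonneg (fun n => by positivity) hs.summable]
  refine tsum_congr fun n => ?_
  rw [← ENNReal.ofReal_mul (by positivity), mul_pow]
  congr 1
  ring

/-- The coefficient of the term with multi-index `k` in the series. -/
noncomputable def mixWeight (r : ℕ) (ρ : ℕ → ℝ) (k : Fin (r - 1) → ℕ) : ℝ :=
  ∏ i : Fin (r - 1),
    ρ (r - 1) / ρ i * (((2 * k i)! : ℝ) / (((k i)! : ℝ) ^ 2 * 4 ^ k i)) *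
      (1 - ρ (r - 1) ^ 2 / ρ i ^ 2) ^ k i

lemma mixWeight_factor_nonneg {a b : ℝ} (ha : 0 < a) (hab : a ≤ b) (n : ℕ) :
    0 ≤ a / b * (((2 * n)! : ℝ) / ((n ! : ℝ) ^ 2 * 4 ^ n)) * (1 - a ^ 2 / b ^ 2) ^ n := by
  have hb : 0 < b := ha.trans_le hab
  have hz : 0 ≤ 1 - a ^ 2 / b ^ 2 := by
    rw [sub_nonneg, div_le_one (by positivity)]
    gcongr
  positivity

lemma mixWeight_nonneg {r : ℕ} {ρ : ℕ → ℝ} (hpos : 0 < ρ (r - 1)) (hanti : Antitone ρ)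
    (k : Fin (r - 1) → ℕ) : 0 ≤ mixWeight r ρ k :=
  Finset.prod_nonneg fun i _ => mixWeight_factor_nonneg hpos (hanti i.2.le) _

lemma tsum_mixWeight_mul {r : ℕ} (hr : 1 ≤ r) {ρ : ℕ → ℝ} (hpos : 0 < ρ (r - 1))
    (hanti : Antitone ρ) {t : ℝ} (ht : ∀ i < r, ρ i ^ 2 * t ^ 2 < 1) :
    ∑' k : Fin (r - 1) → ℕ, ENNReal.ofReal (mixWeight r ρ k) *
      ENNReal.ofReal ((1 / (1 - ρ (r - 1) ^ 2 * t ^ 2)) ^ ((r : ℝ) / 2 + ∑ i, (k i : ℝ))) =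
    ENNReal.ofReal (∏ i ∈ Finset.range r, (√(1 - ρ i ^ 2 * t ^ 2))⁻¹) := by
  obtain ⟨n, rfl⟩ : ∃ n, r = n + 1 := ⟨r - 1, by omega⟩
  have hu : 0 < 1 - ρ n ^ 2 * t ^ 2 := by linarith [ht n (by omega)]
  set v := 1 - ρ n ^ 2 * t ^ 2 with hv
  have hsplit : ∀ k : Fin n → ℕ,
      (1 / v) ^ (((n + 1 : ℕ) : ℝ) / 2 + ∑ i, (k i : ℝ)) =
        (√v)⁻¹ ^ (n + 1) * ∏ i, (1 / v) ^ k i := by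
    intro k
    rw [Real.rpow_add (by positivity), Finset.prod_pow_eq_pow_sum, ← Nat.cast_sum,
      Real.rpow_natCast, show ((n + 1 : ℕ) : ℝ) / 2 = (1 / 2 : ℝ) * ((n + 1 : ℕ) : ℝ) by ring,
      Real.rpow_mul (by positivity), Real.rpow_natCast, ← Real.sqrt_eq_rpow, one_div,
      Real.sqrt_inv]
  have hw : ∀ k : Fin n → ℕ, ENNReal.ofReal (mixWeight (n + 1) ρ k) *
      ENNReal.ofReal ((1 / v) ^ (((n + 1 : ℕ) : ℝ) / 2 + ∑ i, (k i : ℝ))) =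
      ENNReal.ofReal ((√v)⁻¹ ^ (n + 1)) * ∏ i : Fin n,
        (ENNReal.ofReal (ρ n / ρ i * (((2 * k i)! : ℝ) / (((k i)! : ℝ) ^ 2 * 4 ^ k i)) *
          (1 - ρ n ^ 2 / ρ i ^ 2) ^ k i) * ENNReal.ofReal ((1 / v) ^ k i)) := by
    intro k
    have hmix : ENNReal.ofReal (mixWeight (n + 1) ρ k) = ∏ i : Fin n,
        ENNReal.ofReal (ρ n / ρ i * (((2 * k i)! : ℝ) / (((k i)! : ℝ) ^ 2 * 4 ^ k i)) *
          (1 - ρ n ^ 2 / ρ i ^ 2) ^ k i) :=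
      ENNReal.ofReal_prod_of_nonneg fun (i : Fin n) _ =>
        mixWeight_factor_nonneg hpos (hanti i.2.le) (k i)
    rw [hsplit, ENNReal.ofReal_mul (by positivity), Finset.prod_mul_distrib, hmix,
      ENNReal.ofReal_prod_of_nonneg (s := Finset.univ) (f := fun i => (1 / v) ^ k i)
        (fun i _ => by positivity)]
    exact mul_left_comm _ _ _
  refine (tsum_congr hw).trans ?_
  change ∑' k : Fin n → ℕ, ENNReal.ofReal ((√v)⁻¹ ^ (n + 1)) * ∏ i : Fin n,
        (ENNReal.ofReal (ρ n / ρ i * (((2 * k i)! : ℝ) / (((k i)! : ℝ) ^ 2 * 4 ^ k i)) *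
          (1 - ρ n ^ 2 / ρ i ^ 2) ^ k i) * ENNReal.ofReal ((1 / v) ^ k i)) = _
  rw [ENNReal.tsum_mul_left, tsum_pi_prod (fun (i : Fin n) j =>
    ENNReal.ofReal (ρ n / ρ i * (((2 * j)! : ℝ) / ((j ! : ℝ) ^ 2 * 4 ^ j)) *
          (1 - ρ n ^ 2 / ρ i ^ 2) ^ j) * ENNReal.ofReal ((1 / v) ^ j))]
  simp_rw [hv]
  rw [Finset.prod_congr rfl fun (i : Fin n) _ =>
    tsum_factor (a := ρ n) hpos (hanti i.2.le) (ht i (by omega)), ← hv,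
    ← ENNReal.ofReal_prod_of_nonneg (fun i _ => by positivity),
    ← ENNReal.ofReal_mul (by positivity), Finset.prod_mul_distrib, Finset.prod_const,
    Finset.card_univ, Fintype.card_fin, Finset.prod_range_succ, ← hv,
    Fin.prod_univ_eq_prod_range (fun i => (√(1 - ρ i ^ 2 * t ^ 2))⁻¹) n]
  congr 1
  -- The exponent `r/2` supplies `r = n + 1` factors `v^{-1/2}`. The `n` larger correlations cancel
  -- all but one, which is the factor of the smallest correlation itself.
  have hcancel : (√v)⁻¹ ^ (n + 1) * √v ^ n = (√v)⁻¹ := by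
    rw [pow_succ, mul_right_comm, ← mul_pow, inv_mul_cancel₀ (by positivity), one_pow, one_mul]
  rw [← mul_assoc, hcancel, mul_comm]

lemma summable_mixWeight {r : ℕ} (hr : 1 ≤ r) {ρ : ℕ → ℝ} (hpos : 0 < ρ (r - 1))
    (hanti : Antitone ρ) : Summable (mixWeight r ρ) := by
  -- At `t = 0` the identity says that the weights have total mass 1.
  have h := tsum_mixWeight_mul hr hpos hanti (t := 0) (by simp)
  simp only [ne_eq, OfNat.ofNat_ne_zero, not_false_eq_true, zero_pow, mul_zero, sub_zero, div_one,
    Real.one_rpow, ENNReal.ofReal_one, mul_one] at h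
  have hs := ENNReal.summable_toReal (h.trans_ne ENNReal.ofReal_ne_top)
  exact hs.congr fun k => ENNReal.toReal_ofReal (mixWeight_nonneg hpos hanti k)

end GaussianInfo

/-! ### Terms of the series and their behaviour at the mutual information. -/

namespace GaussianInfo

open scoped MatrixOrder Nat ENNReal NNReal

/-- The Bessel function blows up at 0, but its product with the power is the integral
`besselIntegral`, which is continuous and bounded by its value at 0 when the order is positive. -/
lemma pdfTerm_eq_mixWeight_mul {r : ℕ} (hr : 1 ≤ r) {ρ : ℕ → ℝ} (hpos : 0 < ρ (r - 1)) {I x : ℝ}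
    (hx : x ≠ I) (k : Fin (r - 1) → ℕ) :
    pdfTerm r ρ I x k = mixWeight r ρ k *
      (besselIntegral (((r : ℝ) - 1) / 2 + ∑ i, (k i : ℝ)) ((x - I) / ρ (r - 1)) /
        (2 * Real.Gamma ((r : ℝ) / 2 + ∑ i, (k i : ℝ)))) := by
  have hν : 0 ≤ ((r : ℝ) - 1) / 2 + ∑ i, (k i : ℝ) := by
    have : (1 : ℝ) ≤ r := by exact_mod_cast hr
    have : 0 ≤ ∑ i, (k i : ℝ) := by positivity
    linarith
  have hz : 0 < |(x - I) / ρ (r - 1)| := abs_pos.2 (div_ne_zero (sub_ne_zero.2 hx) hpos.ne')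
  have hhalf : |(x - I) / (2 * ρ (r - 1))| = |(x - I) / ρ (r - 1)| / 2 := by
    rw [mul_comm 2, ← div_div, abs_div _ (2 : ℝ), abs_two]
  have h := besselK_mul_rpow hν hz
  rw [besselIntegral_abs] at h
  rw [pdfTerm, hhalf, ← mixWeight, mul_assoc, div_mul_eq_mul_div, h, div_div]

lemma pdfTerm_nonneg {r : ℕ} (hr : 1 ≤ r) {ρ : ℕ → ℝ} (hpos : 0 < ρ (r - 1))
    (hanti : Antitone ρ) {I x : ℝ} (hx : x ≠ I) (k : Fin (r - 1) → ℕ) :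
    0 ≤ pdfTerm r ρ I x k := by
  rw [pdfTerm_eq_mixWeight_mul hr hpos hx]
  have h1 := mixWeight_nonneg hpos hanti k
  have h2 := besselIntegral_nonneg (((r : ℝ) - 1) / 2 + ∑ i, (k i : ℝ)) ((x - I) / ρ (r - 1))
  have h3 : 0 < Real.Gamma ((r : ℝ) / 2 + ∑ i, (k i : ℝ)) := by
    apply Real.Gamma_pos_of_pos
    have : (1 : ℝ) ≤ r := by exact_mod_cast hr
    positivity
  positivity

/-- The limit of the term with multi-index `k` of the series at the mutual information. -/
noncomputable def pdfTermLimit (r : ℕ) (ρ : ℕ → ℝ) (k : Fin (r - 1) → ℕ) : ℝ :=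
  mixWeight r ρ k * (Real.Gamma (((r : ℝ) - 1) / 2 + ∑ i, (k i : ℝ)) /
    (2 * Real.Gamma ((r : ℝ) / 2 + ∑ i, (k i : ℝ))))

lemma order_pos {r : ℕ} (hr : 2 ≤ r) (k : Fin (r - 1) → ℕ) :
    0 < ((r : ℝ) - 1) / 2 + ∑ i, (k i : ℝ) := by
  have : (2 : ℝ) ≤ r := by exact_mod_cast hr
  have : 0 ≤ ∑ i, (k i : ℝ) := by positivity
  linarith

lemma Gamma_shape_pos {r : ℕ} (hr : 1 ≤ r) (k : Fin (r - 1) → ℕ) :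
    0 < Real.Gamma ((r : ℝ) / 2 + ∑ i, (k i : ℝ)) := by
  apply Real.Gamma_pos_of_pos
  have : (1 : ℝ) ≤ r := by exact_mod_cast hr
  positivity

lemma pdfTermLimit_nonneg {r : ℕ} (hr : 2 ≤ r) {ρ : ℕ → ℝ} (hpos : 0 < ρ (r - 1))
    (hanti : Antitone ρ) (k : Fin (r - 1) → ℕ) : 0 ≤ pdfTermLimit r ρ k := by
  have h1 := mixWeight_nonneg hpos hanti k
  have h2 := Real.Gamma_pos_of_pos (order_pos hr k)
  have h3 := Gamma_shape_pos (by omega) k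
  unfold pdfTermLimit
  positivity

lemma summable_pdfTermLimit {r : ℕ} (hr : 2 ≤ r) {ρ : ℕ → ℝ} (hpos : 0 < ρ (r - 1))
    (hanti : Antitone ρ) : Summable (pdfTermLimit r ρ) := by
  refine Summable.of_nonneg_of_le (pdfTermLimit_nonneg hr hpos hanti) (fun k => ?_)
    ((summable_mixWeight (by omega) hpos hanti).mul_right
      (Real.Gamma ((r : ℝ) / 2 - 1 / 2) / Real.Gamma ((r : ℝ) / 2) / 2))
  refine mul_le_mul_of_nonneg_left ?_ (mixWeight_nonneg hpos hanti k)
  have hm : 1 ≤ (r : ℝ) / 2 := by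
    have : (2 : ℝ) ≤ r := by exact_mod_cast hr
    linarith
  have h := Gamma_half_ratio_le hm (∑ i, k i)
  push_cast at h
  rw [mul_comm 2, ← div_div, show ((r : ℝ) - 1) / 2 = (r : ℝ) / 2 - 1 / 2 by ring]
  gcongr

lemma pdfTerm_le_pdfTermLimit {r : ℕ} (hr : 2 ≤ r) {ρ : ℕ → ℝ} (hpos : 0 < ρ (r - 1))
    (hanti : Antitone ρ) {I x : ℝ} (hx : x ≠ I) (k : Fin (r - 1) → ℕ) :
    pdfTerm r ρ I x k ≤ pdfTermLimit r ρ k := by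
  rw [pdfTerm_eq_mixWeight_mul (by omega) hpos hx, pdfTermLimit]
  have h1 := mixWeight_nonneg hpos hanti k
  have h3 := Gamma_shape_pos (by omega) k
  gcongr
  exact besselIntegral_le_Gamma (order_pos hr k) _

lemma tendsto_pdfTerm {r : ℕ} (hr : 2 ≤ r) {ρ : ℕ → ℝ} (hpos : 0 < ρ (r - 1)) (I : ℝ)
    (k : Fin (r - 1) → ℕ) :
    Tendsto (fun x => pdfTerm r ρ I x k) (𝓝[≠] I) (𝓝 (pdfTermLimit r ρ k)) := by
  have hc : Continuous fun x => mixWeight r ρ k *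
      (besselIntegral (((r : ℝ) - 1) / 2 + ∑ i, (k i : ℝ)) ((x - I) / ρ (r - 1)) /
        (2 * Real.Gamma ((r : ℝ) / 2 + ∑ i, (k i : ℝ)))) := by
    have := continuous_besselIntegral (order_pos hr k)
    fun_prop
  have ht := (hc.tendsto I).mono_left (nhdsWithin_le_nhds (s := {I}ᶜ))
  simp only [sub_self, zero_div, besselIntegral_zero (order_pos hr k)] at ht
  refine ht.congr' ?_
  filter_upwards [self_mem_nhdsWithin] with x hx
  exact (pdfTerm_eq_mixWeight_mul (by omega) hpos hx k).symm

lemma summable_pdfTerm {r : ℕ} (hr : 1 ≤ r) {ρ : ℕ → ℝ} (hpos : 0 < ρ (r - 1))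
    (hanti : Antitone ρ) {I x : ℝ} (hx : x ≠ I) : Summable (pdfTerm r ρ I x) := by
  rcases hr.eq_or_lt with rfl | h2
  -- For `r = 1` the order is 0 and domination by the limit fails, but there is only one term.
  · have : Finite (Fin (1 - 1) → ℕ) := inferInstanceAs (Finite (Fin 0 → ℕ))
    exact Summable.of_finite
  · exact Summable.of_nonneg_of_le (pdfTerm_nonneg hr hpos hanti hx)
      (pdfTerm_le_pdfTermLimit h2 hpos hanti hx) (summable_pdfTermLimit h2 hpos hanti)

lemma tendsto_pdfSeries {r : ℕ} (hr : 2 ≤ r) {ρ : ℕ → ℝ} (hpos : 0 < ρ (r - 1))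
    (hanti : Antitone ρ) (I : ℝ) :
    Tendsto (fun x => pdfSeries r ρ I x) (𝓝[≠] I)
      (𝓝 (1 / (ρ (r - 1) * √Real.pi) * ∑' k, pdfTermLimit r ρ k)) := by
  refine Tendsto.const_mul _ (tendsto_tsum_of_dominated_convergence
    (summable_pdfTermLimit hr hpos hanti) (tendsto_pdfTerm hr hpos I) ?_)
  filter_upwards [self_mem_nhdsWithin] with x hx k
  rw [Real.norm_of_nonneg (pdfTerm_nonneg (by omega) hpos hanti hx k)]
  exact pdfTerm_le_pdfTermLimit hr hpos hanti hx k

/-! ### Gaussian laws with Gamma-distributed variance. -/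

lemma measurable_gammaPDF (a b : ℝ) : Measurable (gammaPDF a b) :=
  (measurable_gammaPDFReal a b).ennreal_ofReal

lemma setLIntegral_Ioi_gammaPDF {a b : ℝ} (ha : 0 < a) (hb : 0 < b) :
    ∫⁻ s in Set.Ioi 0, gammaPDF a b s = 1 := by
  have h := lintegral_gammaPDF_eq_one ha hb
  rw [← lintegral_add_compl _ measurableSet_Ioi (A := Set.Ioi 0), Set.compl_Ioi,
    ← setLIntegral_congr Iio_ae_eq_Iic, lintegral_gammaPDF_of_nonpos le_rfl, add_zero] at h
  exact h

/-- The density of a Gaussian with mean `I` whose variance is `2 c² s`, with `s` distributed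
according to the Gamma distribution with shape `m` and rate `1`. -/
noncomputable def gammaMixturePDF (I c m x : ℝ) : ℝ≥0∞ :=
  ∫⁻ s in Set.Ioi 0, gammaPDF m 1 s * gaussianPDF I (2 * c ^ 2 * s).toNNReal x

lemma measurable_gammaMixture_integrand (I c m : ℝ) :
    Measurable fun q : ℝ × ℝ => gammaPDF m 1 q.2 * gaussianPDF I (2 * c ^ 2 * q.2).toNNReal q.1 := by
  have h2 : Measurable fun q : ℝ × ℝ => (I, (2 * c ^ 2 * q.2).toNNReal, q.1) := by fun_prop
  exact ((measurable_gammaPDF m 1).comp measurable_snd).mul (measurable_uncurry_gaussianPDF.comp h2)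

lemma measurable_gammaMixturePDF (I c m : ℝ) : Measurable (gammaMixturePDF I c m) :=
  (measurable_gammaMixture_integrand I c m).lintegral_prod_right'

lemma lintegral_exp_mul_gaussianPDF (I t : ℝ) {v : ℝ≥0} (hv : v ≠ 0) :
    ∫⁻ x, ENNReal.ofReal (Real.exp (t * x)) * gaussianPDF I v x =
      ENNReal.ofReal (Real.exp (I * t + v * t ^ 2 / 2)) := by
  have h := congrFun (mgf_id_gaussianReal (μ := I) (v := v)) t
  simp only [mgf, id] at h
  rw [← h, ofReal_integral_eq_lintegral_ofReal (integrable_exp_mul_gaussianReal t)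
    (ae_of_all _ fun x => (Real.exp_pos _).le), gaussianReal_of_var_ne_zero _ hv,
    lintegral_withDensity_eq_lintegral_mul _ (measurable_gaussianPDF _ _) (by fun_prop)]
  simp [mul_comm]

/-- Given `s`, the Gaussian contributes `exp (tI + c²t²s)`. This lowers the Gamma rate from 1 to `1
- c²t²`, and renormalising the Gamma density produces the power. -/
lemma lintegral_exp_mul_gammaMixturePDF (I : ℝ) {c m t : ℝ} (hc : 0 < c) (hm : 0 < m)
    (ht : c ^ 2 * t ^ 2 < 1) :
    ∫⁻ x, ENNReal.ofReal (Real.exp (t * x)) * gammaMixturePDF I c m x =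
      ENNReal.ofReal (Real.exp (t * I)) * ENNReal.ofReal ((1 / (1 - c ^ 2 * t ^ 2)) ^ m) := by
  have hmeas := measurable_gammaMixture_integrand I c m
  have hu : 0 < 1 - c ^ 2 * t ^ 2 := by linarith
  simp_rw [gammaMixturePDF]
  have h1 : ∀ x, ENNReal.ofReal (Real.exp (t * x)) *
      ∫⁻ s in Set.Ioi 0, gammaPDF m 1 s * gaussianPDF I (2 * c ^ 2 * s).toNNReal x =
      ∫⁻ s in Set.Ioi 0, ENNReal.ofReal (Real.exp (t * x)) *
        (gammaPDF m 1 s * gaussianPDF I (2 * c ^ 2 * s).toNNReal x) := fun x =>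
    (lintegral_const_mul _ (hmeas.comp measurable_prodMk_left)).symm
  simp_rw [h1]
  rw [lintegral_lintegral_swap
    (((show Measurable fun q : ℝ × ℝ => ENNReal.ofReal (Real.exp (t * q.1)) by fun_prop).mul
      hmeas).aemeasurable)]
  have h2 : ∀ s ∈ Set.Ioi (0 : ℝ), ∫⁻ x, ENNReal.ofReal (Real.exp (t * x)) *
        (gammaPDF m 1 s * gaussianPDF I (2 * c ^ 2 * s).toNNReal x) =
      ENNReal.ofReal (Real.exp (t * I)) * ENNReal.ofReal ((1 / (1 - c ^ 2 * t ^ 2)) ^ m) *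
        gammaPDF m (1 - c ^ 2 * t ^ 2) s := by
    intro s hs
    have hs : 0 < s := hs
    have hv : (2 * c ^ 2 * s).toNNReal ≠ 0 := by
      have : 0 < 2 * c ^ 2 * s := by positivity
      simpa using this
    simp_rw [mul_left_comm _ (gammaPDF m 1 s)]
    rw [lintegral_const_mul _ (by
        have := measurable_gaussianPDF I (2 * c ^ 2 * s).toNNReal
        fun_prop), lintegral_exp_mul_gaussianPDF I t hv,
      gammaPDF_of_nonneg hs.le, gammaPDF_of_nonneg hs.le, Real.coe_toNNReal _ (by positivity),
      ← ENNReal.ofReal_mul (by positivity), ← ENNReal.ofReal_mul (by positivity),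
      ← ENNReal.ofReal_mul (by positivity), Real.exp_add]
    congr 1
    have hsplit : Real.exp (-((1 - c ^ 2 * t ^ 2) * s)) =
        Real.exp (-(1 * s)) * Real.exp (2 * c ^ 2 * s * t ^ 2 / 2) := by
      rw [← Real.exp_add]
      ring_nf
    rw [hsplit, Real.div_rpow zero_le_one hu.le, Real.one_rpow, mul_comm I t]
    have : (1 - c ^ 2 * t ^ 2) ^ m ≠ 0 := by positivity
    generalize (1 - c ^ 2 * t ^ 2) ^ m = w at this ⊢
    have : Real.Gamma m ≠ 0 := (Real.Gamma_pos_of_pos hm).ne'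
    field_simp
  rw [setLIntegral_congr_fun measurableSet_Ioi h2, lintegral_const_mul _
    (measurable_gammaPDF m _), setLIntegral_Ioi_gammaPDF hm hu, mul_one]

/-- The product of the Gamma and Gaussian densities, as a function of `s`, is a multiple of the
Bessel integrand. The `1/√s` of the Gaussian lowers the shape `m` to the order `m - 1/2`. -/
lemma ofReal_pdfTerm {r : ℕ} (hr : 1 ≤ r) {ρ : ℕ → ℝ} (hpos : 0 < ρ (r - 1))
    (hanti : Antitone ρ) {I x : ℝ} (hx : x ≠ I) (k : Fin (r - 1) → ℕ) :
    ENNReal.ofReal (1 / (ρ (r - 1) * √Real.pi) * pdfTerm r ρ I x k) =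
      ENNReal.ofReal (mixWeight r ρ k) *
        gammaMixturePDF I (ρ (r - 1)) ((r : ℝ) / 2 + ∑ i, (k i : ℝ)) x := by
  have hν : 0 ≤ ((r : ℝ) - 1) / 2 + ∑ i, (k i : ℝ) := by
    have : (1 : ℝ) ≤ r := by exact_mod_cast hr
    have : 0 ≤ ∑ i, (k i : ℝ) := by positivity
    linarith
  have hG := Gamma_shape_pos hr k
  have hw := mixWeight_nonneg hpos hanti k
  have hνm : ((r : ℝ) - 1) / 2 + ∑ i, (k i : ℝ) = (r : ℝ) / 2 + ∑ i, (k i : ℝ) - 1 / 2 := by ring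
  rw [pdfTerm_eq_mixWeight_mul hr hpos hx]
  rw [hνm] at hν ⊢
  set m := (r : ℝ) / 2 + ∑ i, (k i : ℝ)
  set c := ρ (r - 1)
  have hz : (x - I) / c ≠ 0 := div_ne_zero (sub_ne_zero.2 hx) hpos.ne'
  rw [show 1 / (c * √Real.pi) * (mixWeight r ρ k *
      (besselIntegral (m - 1 / 2) ((x - I) / c) / (2 * Real.Gamma m))) =
      mixWeight r ρ k * (1 / (2 * c * √Real.pi * Real.Gamma m) *
        besselIntegral (m - 1 / 2) ((x - I) / c)) by field_simp,
    ENNReal.ofReal_mul hw, besselIntegral, ← integral_const_mul,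
    ofReal_integral_eq_lintegral_ofReal ((integrableOn_besselIntegrand hν hz).const_mul _)]
  · congr 1
    refine setLIntegral_congr_fun measurableSet_Ioi fun s hs => ?_
    have hs : 0 < s := hs
    rw [gammaPDF_of_nonneg hs.le, gaussianPDF, ← ENNReal.ofReal_mul (by positivity),
      gaussianPDFReal, Real.coe_toNNReal _ (by positivity)]
    congr 1
    have h1 : √(2 * Real.pi * (2 * c ^ 2 * s)) = 2 * c * √Real.pi * √s := by
      rw [show 2 * Real.pi * (2 * c ^ 2 * s) = (2 * c) ^ 2 * (Real.pi * s) by ring,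
        Real.sqrt_mul (by positivity), Real.sqrt_sq (by positivity),
        Real.sqrt_mul (by positivity), mul_assoc (2 * c)]
    have h2 : s ^ (m - 1 / 2 - 1) = s ^ (m - 1) / √s := by
      rw [show m - 1 / 2 - 1 = m - 1 - 1 / 2 by ring, Real.rpow_sub hs, ← Real.sqrt_eq_rpow]
    have h3 : -s - ((x - I) / c) ^ 2 / (4 * s) = -(1 * s) + -(x - I) ^ 2 / (2 * (2 * c ^ 2 * s)) := by
      field_simp
      ring
    rw [h1, h2, h3, Real.exp_add, Real.one_rpow]
    have : √s ≠ 0 := by positivity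
    field_simp
  · filter_upwards [ae_restrict_mem measurableSet_Ioi] with s hs
    have hs : 0 < s := hs
    simp only [Pi.zero_apply]
    positivity

/-- The density of the information density, as a mixture with values in `ℝ≥0∞`. -/
noncomputable def mixturePDF (r : ℕ) (ρ : ℕ → ℝ) (I x : ℝ) : ℝ≥0∞ :=
  ∑' k : Fin (r - 1) → ℕ, ENNReal.ofReal (mixWeight r ρ k) *
    gammaMixturePDF I (ρ (r - 1)) ((r : ℝ) / 2 + ∑ i, (k i : ℝ)) x

lemma measurable_mixturePDF (r : ℕ) (ρ : ℕ → ℝ) (I : ℝ) : Measurable (mixturePDF r ρ I) :=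
  Measurable.tsum fun _ => (measurable_gammaMixturePDF _ _ _).const_mul _

lemma ofReal_pdfSeries {r : ℕ} (hr : 1 ≤ r) {ρ : ℕ → ℝ} (hpos : 0 < ρ (r - 1))
    (hanti : Antitone ρ) {I x : ℝ} (hx : x ≠ I) :
    ENNReal.ofReal (pdfSeries r ρ I x) = mixturePDF r ρ I x := by
  rw [pdfSeries, ← tsum_mul_left, ENNReal.ofReal_tsum_of_nonneg
    (fun k => mul_nonneg (by positivity) (pdfTerm_nonneg hr hpos hanti hx k))
    ((summable_pdfTerm hr hpos hanti hx).mul_left _)]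
  exact tsum_congr fun k => ofReal_pdfTerm hr hpos hanti hx k

lemma lintegral_exp_mul_mixturePDF {r : ℕ} (hr : 1 ≤ r) {ρ : ℕ → ℝ} (hpos : 0 < ρ (r - 1))
    (hanti : Antitone ρ) (I : ℝ) {t : ℝ} (ht : ∀ i < r, ρ i ^ 2 * t ^ 2 < 1) :
    ∫⁻ x, ENNReal.ofReal (Real.exp (t * x)) * mixturePDF r ρ I x =
      ENNReal.ofReal (Real.exp (t * I) * ∏ i ∈ Finset.range r, (√(1 - ρ i ^ 2 * t ^ 2))⁻¹) := by
  simp_rw [mixturePDF, ← ENNReal.tsum_mul_left]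
  rw [lintegral_tsum fun k => by
    have := measurable_gammaMixturePDF I (ρ (r - 1)) ((r : ℝ) / 2 + ∑ i, (k i : ℝ))
    fun_prop]
  have hm : ∀ k : Fin (r - 1) → ℕ, 0 < (r : ℝ) / 2 + ∑ i, (k i : ℝ) := fun k => by
    have : (1 : ℝ) ≤ r := by exact_mod_cast hr
    positivity
  have h : ∀ k : Fin (r - 1) → ℕ, ∫⁻ x, ENNReal.ofReal (Real.exp (t * x)) *
      (ENNReal.ofReal (mixWeight r ρ k) *
        gammaMixturePDF I (ρ (r - 1)) ((r : ℝ) / 2 + ∑ i, (k i : ℝ)) x) =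
      ENNReal.ofReal (Real.exp (t * I)) * (ENNReal.ofReal (mixWeight r ρ k) *
      ENNReal.ofReal ((1 / (1 - ρ (r - 1) ^ 2 * t ^ 2)) ^ ((r : ℝ) / 2 + ∑ i, (k i : ℝ)))) := by
    intro k
    have hmeas := measurable_gammaMixturePDF I (ρ (r - 1)) ((r : ℝ) / 2 + ∑ i, (k i : ℝ))
    simp_rw [mul_left_comm _ (ENNReal.ofReal (mixWeight r ρ k))]
    rw [lintegral_const_mul _ (by fun_prop),
      lintegral_exp_mul_gammaMixturePDF I hpos (hm k) (ht (r - 1) (by omega))]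
  simp_rw [h]
  rw [ENNReal.tsum_mul_left, tsum_mixWeight_mul hr hpos hanti ht,
    ENNReal.ofReal_mul (Real.exp_pos _).le]

end GaussianInfo

/-! ### Spectrum of the off-diagonal block matrix and inverse square roots. -/

namespace GaussianInfo

open scoped MatrixOrder Nat ENNReal NNReal Matrix

/-- For `t ≠ 0`, evaluate the characteristic polynomial at `1/t` and multiply by `t` once per index.
-/
lemma prod_one_sub_mul_eq_det {ι : Type*} [Fintype ι] [DecidableEq ι] {M : Matrix ι ι ℝ}
    {v : ι → ℝ} (h : M.charpoly = ∏ i, (Polynomial.X - Polynomial.C (v i))) (t : ℝ) :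
    ∏ i, (1 - t * v i) = (1 - t • M).det := by
  rcases eq_or_ne t 0 with rfl | ht
  · simp
  have h1 := congrArg (Polynomial.eval t⁻¹) h
  rw [Matrix.eval_charpoly, Polynomial.eval_prod] at h1
  simp only [Polynomial.eval_sub, Polynomial.eval_X, Polynomial.eval_C] at h1
  have h2 : (1 - t • M) = t • (Matrix.scalar ι t⁻¹ - M) := by
    rw [smul_sub, Matrix.scalar_apply, ← Matrix.smul_one_eq_diagonal, smul_smul,
      mul_inv_cancel₀ ht, one_smul]
  rw [h2, Matrix.det_smul, h1, ← Finset.card_univ, ← Finset.prod_const, ← Finset.prod_mul_distrib]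
  refine Finset.prod_congr rfl fun i _ => ?_
  field_simp

variable {p q : ℕ}

lemma charpoly_transpose_mul_self (A : Matrix (Fin p) (Fin q) ℝ) :
    (Aᵀ * A).charpoly = ∏ i : Fin q, (Polynomial.X -
      Polynomial.C ((Matrix.toEuclideanLin A).singularValues i ^ 2)) := by
  have hsymm := (Matrix.toEuclideanLin A).isSymmetric_adjoint_comp_self
  have hn : Module.finrank ℝ (EuclideanSpace ℝ (Fin q)) = q := by simp
  have h := hsymm.charpoly_eq hn
  have hT : LinearMap.adjoint (Matrix.toEuclideanLin A) ∘ₗ Matrix.toEuclideanLin A =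
      Matrix.toEuclideanLin (Aᵀ * A) := by
    rw [← Matrix.toEuclideanLin_conjTranspose_eq_adjoint, Matrix.conjTranspose_eq_transpose_of_trivial]
    ext1 x
    simp [Matrix.toLpLin_apply]
  have hcp : (Aᵀ * A).charpoly =
      (LinearMap.adjoint (Matrix.toEuclideanLin A) ∘ₗ Matrix.toEuclideanLin A).charpoly := by
    rw [hT, ← LinearMap.charpoly_toMatrix _ (EuclideanSpace.basisFun (Fin q) ℝ).toBasis,
      Matrix.toEuclideanLin_eq_toLin_orthonormal, LinearMap.toMatrix_toLin]
  rw [hcp, h]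
  refine Finset.prod_congr rfl fun i _ => ?_
  rw [(Matrix.toEuclideanLin A).sq_singularValues_fin hn i]
  rfl

lemma rank_eq_finrank_range (A : Matrix (Fin p) (Fin q) ℝ) :
    A.rank = Module.finrank ℝ (Matrix.toEuclideanLin A).range := by
  rw [A.rank_eq_finrank_range_toLin (EuclideanSpace.basisFun _ ℝ).toBasis
    (EuclideanSpace.basisFun _ ℝ).toBasis, Matrix.toEuclideanLin_eq_toLin_orthonormal]

/-- The off-diagonal block matrix with blocks `A` and `Aᵀ`. -/
def offDiagBlocks (A : Matrix (Fin p) (Fin q) ℝ) : Matrix (Fin p ⊕ Fin q) (Fin p ⊕ Fin q) ℝ :=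
  Matrix.fromBlocks 0 A Aᵀ 0

lemma isHermitian_offDiagBlocks (A : Matrix (Fin p) (Fin q) ℝ) : (offDiagBlocks A).IsHermitian := by
  rw [Matrix.IsHermitian, Matrix.conjTranspose_eq_transpose_of_trivial, offDiagBlocks,
    Matrix.fromBlocks_transpose]
  simp

lemma sum_eigenvalues_offDiagBlocks (A : Matrix (Fin p) (Fin q) ℝ) :
    ∑ j, (isHermitian_offDiagBlocks A).eigenvalues j = 0 := by
  have h := (isHermitian_offDiagBlocks A).trace_eq_sum_eigenvalues
  have h0 : (offDiagBlocks A).trace = 0 := by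
    simp [offDiagBlocks, Matrix.trace, Fintype.sum_sum_type]
  rw [h0] at h
  exact h.symm

/-- The Schur complement reduces the determinant to that of `1 - t² AᵀA`, whose factors come from
the squared singular values. Those beyond the rank vanish and contribute 1. -/
lemma prod_one_sub_mul_eigenvalues_offDiagBlocks (A : Matrix (Fin p) (Fin q) ℝ) (t : ℝ) :
    ∏ j, (1 - t * (isHermitian_offDiagBlocks A).eigenvalues j) =
      ∏ i ∈ Finset.range A.rank,
        (1 - (Matrix.toEuclideanLin A).singularValues i ^ 2 * t ^ 2) := by
  have hblock : 1 - t • offDiagBlocks A = Matrix.fromBlocks 1 (-t • A) (-t • Aᵀ) 1 := by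
    rw [offDiagBlocks, Matrix.fromBlocks_smul, ← Matrix.fromBlocks_one, sub_eq_add_neg,
      Matrix.fromBlocks_neg, Matrix.fromBlocks_add]
    simp
  have hmul : 1 - -t • Aᵀ * -t • A = 1 - t ^ 2 • (Aᵀ * A) := by
    rw [Matrix.smul_mul, Matrix.mul_smul, smul_smul]
    ring_nf
  rw [prod_one_sub_mul_eq_det (v := (isHermitian_offDiagBlocks A).eigenvalues)
    (isHermitian_offDiagBlocks A).charpoly_eq, hblock,
    Matrix.det_fromBlocks_one₁₁, hmul,
    ← prod_one_sub_mul_eq_det (charpoly_transpose_mul_self A),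
    Fin.prod_univ_eq_prod_range
      (fun i => 1 - t ^ 2 * (Matrix.toEuclideanLin A).singularValues i ^ 2) q]
  have hle : A.rank ≤ q := by simpa using A.rank_le_width
  refine ((Finset.prod_subset (Finset.range_mono hle) fun i _ hi => ?_).trans ?_).symm
  · rw [Finset.mem_range, not_lt, rank_eq_finrank_range] at hi
    rw [(LinearMap.singularValues_eq_zero_iff_le_finrank_range _).2 hi]
    simp
  · exact Finset.prod_congr rfl fun i _ => by rw [mul_comm]

lemma transpose_mul_mul_eigenvectorUnitary {ι : Type*} [Fintype ι] [DecidableEq ι]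
    {M : Matrix ι ι ℝ} (hM : M.IsHermitian) :
    (hM.eigenvectorUnitary : Matrix ι ι ℝ)ᵀ * (1 + M) * (hM.eigenvectorUnitary : Matrix ι ι ℝ) =
      Matrix.diagonal fun j => 1 + hM.eigenvalues j := by
  have h := hM.conjStarAlgAut_star_eigenvectorUnitary
  have hU : star (hM.eigenvectorUnitary : Matrix ι ι ℝ) = (hM.eigenvectorUnitary : Matrix ι ι ℝ)ᵀ := by
    rw [Matrix.star_eq_conjTranspose, Matrix.conjTranspose_eq_transpose_of_trivial]
  rw [Unitary.conjStarAlgAut_star_apply, hU] at h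
  have h1 := Unitary.coe_star_mul_self hM.eigenvectorUnitary
  rw [hU] at h1
  rw [Matrix.mul_add, Matrix.add_mul, h, Matrix.mul_one, h1, ← Matrix.diagonal_one,
    Matrix.diagonal_add]
  rfl

lemma sqrt_inv_mul_mul {n : ℕ} {R : Matrix (Fin n) (Fin n) ℝ} (hR : R.PosSemidef)
    (hu : IsUnit R) :
    IsUnit (CFC.sqrt R)⁻¹ ∧ (CFC.sqrt R)⁻¹ᵀ = (CFC.sqrt R)⁻¹ ∧
      (CFC.sqrt R)⁻¹ * R * (CFC.sqrt R)⁻¹ = 1 := by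
  have h0 : 0 ≤ R := Matrix.nonneg_iff_posSemidef.2 hR
  have hsq : CFC.sqrt R * CFC.sqrt R = R := CFC.sqrt_mul_sqrt_self R
  have hS : IsUnit (CFC.sqrt R) := by
    have : IsUnit (CFC.sqrt R * CFC.sqrt R) := by rwa [hsq]
    exact isUnit_of_mul_isUnit_left this
  have hdet := (Matrix.isUnit_iff_isUnit_det _).1 hS
  have hT : (CFC.sqrt R)ᵀ = CFC.sqrt R := by
    have := (Matrix.nonneg_iff_posSemidef.1 (CFC.sqrt_nonneg R)).isHermitian
    rwa [Matrix.IsHermitian, Matrix.conjTranspose_eq_transpose_of_trivial] at this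
  refine ⟨?_, ?_, ?_⟩
  · rwa [Matrix.isUnit_nonsing_inv_iff]
  · rw [Matrix.transpose_nonsing_inv, hT]
  · nth_rewrite 2 [← hsq]
    rw [← Matrix.mul_assoc, Matrix.nonsing_inv_mul _ hdet, Matrix.one_mul,
      Matrix.mul_nonsing_inv _ hdet]

end GaussianInfo

/-! ### Whitening of the Gaussian pair. -/

namespace GaussianInfo

open scoped MatrixOrder ENNReal NNReal Matrix

variable {Ω : Type*} [MeasurableSpace Ω] {p q : ℕ}

section Whitening

variable {ι κ : Type*} [Fintype ι] {P : Measure Ω} [IsProbabilityMeasure P]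

lemma mulVec_sub_apply (B : Matrix κ ι ℝ) (w m : ι → ℝ) (i : κ) :
    (B *ᵥ (w - m)) i = (∑ k, B i k * w k) - ∑ k, B i k * m k := by
  rw [Matrix.mulVec_sub]
  rfl

lemma covariance_mulVec {W : Ω → ι → ℝ} (hW : ∀ i, MemLp (fun ω => W ω i) 2 P)
    {C : Matrix ι ι ℝ} (hC : ∀ i j, cov[fun ω => W ω i, fun ω => W ω j; P] = C i j)
    (B : Matrix κ ι ℝ) (m : ι → ℝ) (i j : κ) :
    cov[fun ω => (B *ᵥ (W ω - m)) i, fun ω => (B *ᵥ (W ω - m)) j; P] = (B * C * Bᵀ) i j := by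
  have hL : ∀ i k, MemLp (fun ω => B i k * W ω k) 2 P := fun i k => (hW k).const_mul _
  have hI : ∀ i, Integrable (fun ω => ∑ k, B i k * W ω k) P := fun i =>
    integrable_finsetSum _ fun k _ => (hL i k).integrable one_le_two
  simp_rw [mulVec_sub_apply]
  rw [covariance_sub_const_left (hI i), covariance_sub_const_right (hI j),
    covariance_fun_sum_fun_sum (hL i) (hL j)]
  simp_rw [covariance_const_mul_left, covariance_const_mul_right, hC, Matrix.mul_apply,
    Finset.sum_mul, Matrix.transpose_apply]
  rw [Finset.sum_comm]
  exact Finset.sum_congr rfl fun _ _ => Finset.sum_congr rfl fun _ _ => by ring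

lemma posSemidef_of_covariance {W : Ω → ι → ℝ} (hW : ∀ i, MemLp (fun ω => W ω i) 2 P)
    {C : Matrix ι ι ℝ} (hC : ∀ i j, cov[fun ω => W ω i, fun ω => W ω j; P] = C i j) :
    C.PosSemidef := by
  rw [Matrix.posSemidef_iff_dotProduct_mulVec]
  refine ⟨?_, fun x => ?_⟩
  · ext i j
    rw [Matrix.conjTranspose_apply, star_trivial, ← hC, ← hC, covariance_comm]
  -- With the one-row matrix `x`, the quadratic form of `C` at `x` is the variance of a linear
  -- combination.
  · have h := covariance_mulVec hW hC (Matrix.of fun (_ : Unit) k => x k) 0 () ()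
    rw [covariance_self] at h
    · have h2 : ((Matrix.of fun (_ : Unit) k => x k) * C * (Matrix.of fun (_ : Unit) k => x k)ᵀ) () () =
          star x ⬝ᵥ C *ᵥ x := by
        rw [star_trivial, Matrix.dotProduct_mulVec]
        rfl
      rw [← h2, ← h]
      exact variance_nonneg _ _
    · simp_rw [mulVec_sub_apply]
      have := fun k => (hW k).aestronglyMeasurable.aemeasurable
      fun_prop

/-- Uncorrelated coordinates of a Gaussian vector are independent. This serves both the joint law
and the product of the marginals, under the same affine map. -/
lemma map_mulVec_sub_eq_pi [Fintype κ] [DecidableEq κ] {W : Ω → ι → ℝ} (hG : HasGaussianLaw W P)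
    {C : Matrix ι ι ℝ} (hC : ∀ i j, cov[fun ω => W ω i, fun ω => W ω j; P] = C i j)
    {m : ι → ℝ} (hm : ∀ i, ∫ ω, W ω i ∂P = m i) {B : Matrix κ ι ℝ} {d : κ → ℝ}
    (hd : B * C * Bᵀ = Matrix.diagonal d) :
    P.map (fun ω => B *ᵥ (W ω - m)) = Measure.pi fun j => gaussianReal 0 (d j).toNNReal := by
  have hWi : ∀ i, HasGaussianLaw (fun ω => W ω i) P := fun i => hG.eval i
  have hcov := covariance_mulVec (fun i => (hWi i).memLp_two) hC B m
  have hGZ : HasGaussianLaw (fun ω => B *ᵥ (W ω - m)) P := by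
    have h1 : HasGaussianLaw (fun ω => B *ᵥ W ω) P :=
      hG.map_fun (LinearMap.toContinuousLinearMap B.mulVecLin)
    have := h1.isGaussian_map
    refine ⟨?_⟩
    have h2 : P.map (fun ω => B *ᵥ (W ω - m)) =
        (P.map fun ω => B *ᵥ W ω).map fun z => z - B *ᵥ m := by
      rw [AEMeasurable.map_map_of_aemeasurable (by fun_prop) h1.aemeasurable]
      congr 1
      ext1 ω
      rw [Matrix.mulVec_sub]
      rfl
    rw [h2]
    infer_instance
  have hGZi : ∀ j, HasGaussianLaw (fun ω => (B *ᵥ (W ω - m)) j) P := fun j => hGZ.eval j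
  have hind : iIndepFun (fun j ω => (B *ᵥ (W ω - m)) j) P := by
    refine hGZ.iIndepFun_of_covariance_eq_zero fun i j hij => ?_
    rw [hcov, hd, Matrix.diagonal_apply_ne _ hij]
  rw [iIndepFun_iff_map_fun_eq_pi_map fun j => (hGZi j).aemeasurable] at hind
  refine hind.trans ?_
  congr 1
  ext1 j
  rw [(hGZi j).map_eq_gaussianReal, ← covariance_self (hGZi j).aemeasurable, hcov, hd,
    Matrix.diagonal_apply_eq]
  congr 1
  simp_rw [mulVec_sub_apply]
  rw [integral_sub (integrable_finsetSum _ fun k _ => (hWi k).integrable.const_mul _)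
    (integrable_const _), integral_finsetSum _ fun k _ => (hWi k).integrable.const_mul _]
  simp [integral_const_mul, hm]

end Whitening

lemma posSemidef_covMatrix {P : Measure Ω} [IsProbabilityMeasure P]
    {X : Ω → EuclideanSpace ℝ (Fin p)} (hX : HasGaussianLaw X P) :
    (covMatrix P X X).PosSemidef :=
  posSemidef_of_covariance (W := fun ω i => X ω i)
    (fun i => (hX.map_fun (EuclideanSpace.proj i)).memLp_two) fun _ _ => rfl

/-- The vector of all coordinates of a pair of vectors. -/
noncomputable def stack :
    EuclideanSpace ℝ (Fin p) × EuclideanSpace ℝ (Fin q) →L[ℝ] (Fin p ⊕ Fin q → ℝ) :=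
  ContinuousLinearMap.pi (Sum.elim
    (fun i => (EuclideanSpace.proj i).comp (ContinuousLinearMap.fst ℝ _ _))
    (fun i => (EuclideanSpace.proj i).comp (ContinuousLinearMap.snd ℝ _ _)))

@[simp]
lemma stack_inl (z : EuclideanSpace ℝ (Fin p) × EuclideanSpace ℝ (Fin q)) (i : Fin p) :
    stack z (Sum.inl i) = z.1 i := rfl

@[simp]
lemma stack_inr (z : EuclideanSpace ℝ (Fin p) × EuclideanSpace ℝ (Fin q)) (i : Fin q) :
    stack z (Sum.inr i) = z.2 i := rfl

lemma stack_injective : Function.Injective (stack (p := p) (q := q)) := by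
  intro z w h
  ext i
  · exact congrFun h (Sum.inl i)
  · exact congrFun h (Sum.inr i)

lemma covariance_stack {P : Measure Ω} {X : Ω → EuclideanSpace ℝ (Fin p)}
    {Y : Ω → EuclideanSpace ℝ (Fin q)} (i j : Fin p ⊕ Fin q) :
    cov[fun ω => stack (X ω, Y ω) i, fun ω => stack (X ω, Y ω) j; P] =
      Matrix.fromBlocks (covMatrix P X X) (covMatrix P X Y) (covMatrix P X Y)ᵀ
        (covMatrix P Y Y) i j := by
  rcases i with i | i <;> rcases j with j | j <;> simp [covMatrix]
  exact covariance_comm _ _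

lemma measurableEmbedding_whitening {B : Matrix (Fin p ⊕ Fin q) (Fin p ⊕ Fin q) ℝ} (hB : IsUnit B)
    (m : Fin p ⊕ Fin q → ℝ) :
    MeasurableEmbedding fun z : EuclideanSpace ℝ (Fin p) × EuclideanSpace ℝ (Fin q) =>
      B *ᵥ (stack z - m) := by
  refine Continuous.measurableEmbedding (by fun_prop) fun z w h => ?_
  have h1 := Matrix.mulVec_injective_of_isUnit hB h
  exact stack_injective (sub_left_injective h1)

lemma covariance_stack_prod {P : Measure Ω} [IsProbabilityMeasure P]
    {X : Ω → EuclideanSpace ℝ (Fin p)} {Y : Ω → EuclideanSpace ℝ (Fin q)}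
    (hX : HasGaussianLaw X P) (hY : HasGaussianLaw Y P) (i j : Fin p ⊕ Fin q) :
    cov[fun z => stack z i, fun z => stack z j; (P.map X).prod (P.map Y)] =
      Matrix.fromBlocks (covMatrix P X X) 0 0 (covMatrix P Y Y) i j := by
  have := hX.isGaussian_map
  have := hY.isGaussian_map
  have hX2 : ∀ i, MemLp (fun x : EuclideanSpace ℝ (Fin p) => x i) 2 (P.map X) := fun i =>
    (IsGaussian.hasGaussianLaw_id.map_fun (EuclideanSpace.proj i)).memLp_two
  have hY2 : ∀ i, MemLp (fun x : EuclideanSpace ℝ (Fin q) => x i) 2 (P.map Y) := fun i =>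
    (IsGaussian.hasGaussianLaw_id.map_fun (EuclideanSpace.proj i)).memLp_two
  rcases i with i | i <;> rcases j with j | j
  · have h := covariance_map_fun (X := fun x : EuclideanSpace ℝ (Fin p) => x i)
      (Y := fun x => x j) (Z := Prod.fst) (μ := (P.map X).prod (P.map Y))
      (by fun_prop) (by fun_prop) (by fun_prop)
    rw [← Measure.fst, Measure.fst_prod, covariance_map_fun (by fun_prop) (by fun_prop)
      hX.aemeasurable] at h
    exact h.symm
  · exact covariance_fst_snd_prod (hX2 i) (hY2 j)
  · rw [covariance_comm]
    exact covariance_fst_snd_prod (hX2 j) (hY2 i)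
  · have h := covariance_map_fun (X := fun x : EuclideanSpace ℝ (Fin q) => x i)
      (Y := fun x => x j) (Z := Prod.snd) (μ := (P.map X).prod (P.map Y))
      (by fun_prop) (by fun_prop) (by fun_prop)
    rw [← Measure.snd, Measure.snd_prod, covariance_map_fun (by fun_prop) (by fun_prop)
      hY.aemeasurable] at h
    exact h.symm

lemma integral_stack_prod {P : Measure Ω} [IsProbabilityMeasure P]
    {X : Ω → EuclideanSpace ℝ (Fin p)} {Y : Ω → EuclideanSpace ℝ (Fin q)}
    (hX : HasGaussianLaw X P) (hY : HasGaussianLaw Y P) (i : Fin p ⊕ Fin q) :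
    ∫ z, stack z i ∂((P.map X).prod (P.map Y)) = ∫ ω, stack (X ω, Y ω) i ∂P := by
  have := hX.isGaussian_map
  have := hY.isGaussian_map
  rcases i with i | i
  · have h := integral_map (μ := (P.map X).prod (P.map Y)) (φ := Prod.fst) (by fun_prop)
      (f := fun x : EuclideanSpace ℝ (Fin p) => x i) (by fun_prop)
    rw [← Measure.fst, Measure.fst_prod, integral_map hX.aemeasurable (by fun_prop)] at h
    exact h.symm
  · have h := integral_map (μ := (P.map X).prod (P.map Y)) (φ := Prod.snd) (by fun_prop)
      (f := fun x : EuclideanSpace ℝ (Fin q) => x i) (by fun_prop)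
    rw [← Measure.snd, Measure.snd_prod, integral_map hY.aemeasurable (by fun_prop)] at h
    exact h.symm

/-- If `d j ≤ 0`, then `toNNReal` makes the `j`-th marginal the Dirac mass at 0, which is singular
to `N(0, 1)`. -/
lemma pos_of_pi_gaussianReal_absolutelyContinuous {ι : Type*} [Fintype ι] {d : ι → ℝ}
    (h : Measure.pi (fun j => gaussianReal 0 (d j).toNNReal) ≪
      Measure.pi fun _ => gaussianReal 0 1) (j : ι) : 0 < d j := by
  by_contra hj
  have h1 : (Measure.pi fun j => gaussianReal 0 (d j).toNNReal).map (fun z : ι → ℝ => z j) ≪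
      (Measure.pi fun _ : ι => gaussianReal 0 1).map (fun z : ι → ℝ => z j) :=
    h.map (measurable_pi_apply j)
  have h2 : (Measure.pi fun j => gaussianReal 0 (d j).toNNReal).map (fun z : ι → ℝ => z j) = _ :=
    (measurePreserving_eval (fun j => gaussianReal 0 (d j).toNNReal) j).map_eq
  have h3 : (Measure.pi fun _ : ι => gaussianReal 0 1).map (fun z : ι → ℝ => z j) = _ :=
    (measurePreserving_eval (fun _ : ι => gaussianReal 0 1) j).map_eq
  rw [h2, h3, Real.toNNReal_of_nonpos (not_lt.1 hj), gaussianReal_zero_var] at h1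
  have := nullSingletonClass_gaussianReal (μ := 0) (one_ne_zero (α := ℝ≥0))
  have h4 := h1 (measure_singleton (0 : ℝ))
  simp at h4

/-- The eigenvalues of the covariance matrix of the whitened coordinates. -/
noncomputable def whitenedVar (P : Measure Ω) (X : Ω → EuclideanSpace ℝ (Fin p))
    (Y : Ω → EuclideanSpace ℝ (Fin q)) (j : Fin p ⊕ Fin q) : ℝ :=
  1 + (isHermitian_offDiagBlocks (correlationMatrix P X Y)).eigenvalues j

/-- The logarithm of the density of `N(0, d)` with respect to `N(0, 1)`, summed over coordinates. -/
noncomputable def logDensity {ι : Type*} [Fintype ι] (d : ι → ℝ) (z : ι → ℝ) : ℝ :=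
  ∑ j, (-(Real.log (d j) / 2) + (1 - 1 / d j) * z j ^ 2 / 2)

lemma pi_gaussianReal_eq_withDensity {ι : Type*} [Fintype ι] {d : ι → ℝ} (hd : ∀ j, 0 < d j) :
    Measure.pi (fun j => gaussianReal 0 (d j).toNNReal) =
      (Measure.pi fun _ => gaussianReal 0 1).withDensity fun z =>
        ENNReal.ofReal (Real.exp (logDensity d z)) := by
  rw [pi_withDensity (fun _ => gaussianReal 0 1) _ (fun j x =>
    ENNReal.ofReal (Real.exp (-(Real.log (d j) / 2) + (1 - 1 / d j) * x ^ 2 / 2)))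
    (fun j => by fun_prop) fun j => ?_]
  · congr 1
    ext1 z
    rw [logDensity, Real.exp_sum, ENNReal.ofReal_prod_of_nonneg fun j _ => (Real.exp_pos _).le]
  · have h := gaussianReal_eq_withDensity (d := (d j).toNNReal) (by simpa using hd j)
    simpa only [Real.coe_toNNReal _ (hd j).le] using h

/-- One invertible affine map sends the product law to the standard Gaussian and the joint law to a
Gaussian with diagonal covariance, so the density between them can be read off coordinatewise. -/
lemma exists_whitening {P : Measure Ω} [IsProbabilityMeasure P]
    {X : Ω → EuclideanSpace ℝ (Fin p)} {Y : Ω → EuclideanSpace ℝ (Fin q)}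
    (hXY : HasGaussianLaw (fun ω => (X ω, Y ω)) P)
    (hX : IsUnit (covMatrix P X X)) (hY : IsUnit (covMatrix P Y Y))
    (hac : (P.map fun ω => (X ω, Y ω)) ≪ (P.map X).prod (P.map Y)) :
    (∀ j, 0 < whitenedVar P X Y j) ∧ ∃ Z : Ω → Fin p ⊕ Fin q → ℝ, AEMeasurable Z P ∧
      P.map Z = Measure.pi (fun j => gaussianReal 0 (whitenedVar P X Y j).toNNReal) ∧
      infoDensity P X Y =ᵐ[P] fun ω => logDensity (whitenedVar P X Y) (Z ω) := by
  have hGX := hXY.fst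
  have hGY := hXY.snd
  have := hGX.isGaussian_map
  have := hGY.isGaussian_map
  have := hXY.isGaussian_map
  have hG : HasGaussianLaw (fun ω => stack (X ω, Y ω)) P := hXY.map_fun stack
  obtain ⟨hNx, hNxT, hNx1⟩ := sqrt_inv_mul_mul (posSemidef_covMatrix hGX) hX
  obtain ⟨hNy, hNyT, hNy1⟩ := sqrt_inv_mul_mul (posSemidef_covMatrix hGY) hY
  set A := correlationMatrix P X Y with hA
  set Nx := (CFC.sqrt (covMatrix P X X))⁻¹
  set Ny := (CFC.sqrt (covMatrix P Y Y))⁻¹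
  set N := Matrix.fromBlocks Nx 0 0 Ny with hN
  set U : Matrix (Fin p ⊕ Fin q) (Fin p ⊕ Fin q) ℝ :=
    (isHermitian_offDiagBlocks A).eigenvectorUnitary.1 with hU
  have hUU : Uᵀ * U = 1 := by
    have := Unitary.coe_star_mul_self (isHermitian_offDiagBlocks A).eigenvectorUnitary
    rwa [Matrix.star_eq_conjTranspose, Matrix.conjTranspose_eq_transpose_of_trivial] at this
  have hNT : Nᵀ = N := by
    rw [hN, Matrix.fromBlocks_transpose, hNxT, hNyT]
    simp
  have hBT : (Uᵀ * N)ᵀ = N * U := by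
    rw [Matrix.transpose_mul, hNT, Matrix.transpose_transpose]
  have hB : IsUnit (Uᵀ * N) := by
    refine IsUnit.mul (IsUnit.of_mul_eq_one _ hUU) ?_
    rw [Matrix.isUnit_iff_isUnit_det, hN, Matrix.det_fromBlocks_zero₂₁]
    exact ((Matrix.isUnit_iff_isUnit_det _).1 hNx).mul ((Matrix.isUnit_iff_isUnit_det _).1 hNy)
  have hjoint : Uᵀ * N * Matrix.fromBlocks (covMatrix P X X) (covMatrix P X Y)
      (covMatrix P X Y)ᵀ (covMatrix P Y Y) * (Uᵀ * N)ᵀ =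
      Matrix.diagonal (whitenedVar P X Y) := by
    have h1 : N * Matrix.fromBlocks (covMatrix P X X) (covMatrix P X Y)
        (covMatrix P X Y)ᵀ (covMatrix P Y Y) * N = 1 + offDiagBlocks A := by
      have hAT : Aᵀ = Ny * (covMatrix P X Y)ᵀ * Nx := by
        rw [hA, correlationMatrix, Matrix.transpose_mul, Matrix.transpose_mul, hNxT, hNyT,
          Matrix.mul_assoc]
      rw [hN, Matrix.fromBlocks_multiply, Matrix.fromBlocks_multiply, offDiagBlocks, hAT, hA,
        correlationMatrix, ← Matrix.fromBlocks_one, Matrix.fromBlocks_add]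
      simp [hNx1, hNy1, Nx, Ny]
    have h2 := transpose_mul_mul_eigenvectorUnitary (isHermitian_offDiagBlocks A)
    rw [← hU, ← h1] at h2
    rw [hBT]
    simp only [Matrix.mul_assoc] at h2 ⊢
    exact h2
  have hprod : Uᵀ * N * Matrix.fromBlocks (covMatrix P X X) 0 0 (covMatrix P Y Y) * (Uᵀ * N)ᵀ =
      Matrix.diagonal fun _ => 1 := by
    have h1 : N * Matrix.fromBlocks (covMatrix P X X) 0 0 (covMatrix P Y Y) * N = 1 := by
      rw [hN, Matrix.fromBlocks_multiply, Matrix.fromBlocks_multiply]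
      simp [hNx1, hNy1]
    have h2 : Uᵀ * (N * Matrix.fromBlocks (covMatrix P X X) 0 0 (covMatrix P Y Y) * N) * U = 1 := by
      rw [h1, Matrix.mul_one, hUU]
    rw [hBT, Matrix.diagonal_one, ← h2]
    simp only [Matrix.mul_assoc]
  set m : Fin p ⊕ Fin q → ℝ := fun i => ∫ ω, stack (X ω, Y ω) i ∂P with hm
  set T : EuclideanSpace ℝ (Fin p) × EuclideanSpace ℝ (Fin q) → Fin p ⊕ Fin q → ℝ :=
    fun z => (Uᵀ * N) *ᵥ (stack z - m) with hT
  have hTe : MeasurableEmbedding T := measurableEmbedding_whitening hB m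
  have hmapZ : P.map (fun ω => T (X ω, Y ω)) =
      Measure.pi fun j => gaussianReal 0 (whitenedVar P X Y j).toNNReal :=
    map_mulVec_sub_eq_pi hG covariance_stack (fun _ => rfl) hjoint
  have hmapP : (P.map fun ω => (X ω, Y ω)).map T =
      Measure.pi fun j => gaussianReal 0 (whitenedVar P X Y j).toNNReal := by
    rw [AEMeasurable.map_map_of_aemeasurable hTe.measurable.aemeasurable hXY.aemeasurable]
    exact hmapZ
  have hmapQ : ((P.map X).prod (P.map Y)).map T = Measure.pi fun _ => gaussianReal 0 1 := by
    have hGQ : HasGaussianLaw (fun z => stack z) ((P.map X).prod (P.map Y)) :=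
      IsGaussian.hasGaussianLaw_id.map_fun stack
    have := map_mulVec_sub_eq_pi hGQ (covariance_stack_prod hGX hGY)
      (integral_stack_prod hGX hGY) hprod
    simpa using this
  have hpos : ∀ j, 0 < whitenedVar P X Y j := by
    apply pos_of_pi_gaussianReal_absolutelyContinuous
    rw [← hmapP, ← hmapQ]
    exact hac.map hTe.measurable
  refine ⟨hpos, fun ω => T (X ω, Y ω), hTe.measurable.comp_aemeasurable hXY.aemeasurable,
    hmapZ, ?_⟩
  -- An injective change of variables preserves the Radon–Nikodym derivative.
  have hder := hTe.rnDeriv_map (P.map fun ω => (X ω, Y ω)) ((P.map X).prod (P.map Y))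
  rw [hmapP, hmapQ, pi_gaussianReal_eq_withDensity hpos] at hder
  have hden := Measure.rnDeriv_withDensity (Measure.pi fun _ : Fin p ⊕ Fin q => gaussianReal 0 1)
    (f := fun z => ENNReal.ofReal (Real.exp (logDensity (whitenedVar P X Y) z)))
    (by unfold logDensity; fun_prop)
  rw [← hmapQ] at hden hder
  have hden2 := ae_of_ae_map hTe.measurable.aemeasurable hden
  -- Both identities hold almost everywhere for the product law; absolute continuity carries them to
  -- the joint law.
  have hboth := ae_of_ae_map hXY.aemeasurable (hac.ae_le (hder.and hden2))
  filter_upwards [hboth] with ω hω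
  rw [infoDensity, ← hω.1, hω.2, ENNReal.toReal_ofReal (Real.exp_pos _).le, Real.log_exp]

end GaussianInfo

/-! ### Mean and exponential transform of the log density. -/

namespace GaussianInfo

open scoped ENNReal NNReal Matrix

section LogDensity

variable {ι : Type*} [Fintype ι] {d : ι → ℝ}

lemma measurable_logDensity (d : ι → ℝ) : Measurable (logDensity d) := by
  unfold logDensity
  fun_prop

lemma integrable_sq_eval_pi_gaussianReal (v : ι → ℝ≥0) (j : ι) :
    Integrable (fun z : ι → ℝ => z j ^ 2) (Measure.pi fun j => gaussianReal 0 (v j)) := by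
  have h : Integrable (fun x : ℝ => x ^ 2) (gaussianReal 0 (v j)) :=
    (memLp_id_gaussianReal 2).integrable_sq
  exact (measurePreserving_eval (fun j => gaussianReal 0 (v j)) j).integrable_comp_of_integrable h

lemma integral_sq_eval_pi_gaussianReal (v : ι → ℝ≥0) (j : ι) :
    ∫ z : ι → ℝ, z j ^ 2 ∂(Measure.pi fun j => gaussianReal 0 (v j)) = v j := by
  have h : (Measure.pi fun j => gaussianReal 0 (v j)).map (fun z : ι → ℝ => z j) = _ :=
    (measurePreserving_eval (fun j => gaussianReal 0 (v j)) j).map_eq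
  have hmeas : Measurable fun z : ι → ℝ => z j := measurable_pi_apply j
  have h2 := integral_map (μ := Measure.pi fun j => gaussianReal 0 (v j)) hmeas.aemeasurable (f := fun x : ℝ => x ^ 2) (by fun_prop)
  have h3 := variance_of_integral_eq_zero (μ := gaussianReal 0 (v j)) (X := id) (by fun_prop)
    (by simp)
  rw [← h2, h, ← variance_id_gaussianReal (μ := 0) (v := v j), h3]
  rfl

lemma integrable_logDensity (d : ι → ℝ) (v : ι → ℝ≥0) :
    Integrable (logDensity d) (Measure.pi fun j => gaussianReal 0 (v j)) := by
  refine integrable_finsetSum _ fun j _ => (integrable_const _).add ?_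
  exact ((integrable_sq_eval_pi_gaussianReal v j).const_mul _).div_const _

/-- The quadratic part of each coordinate has mean `(d j - 1)/2`, and these cancel in the sum. -/
lemma integral_logDensity (hd : ∀ j, 0 < d j) (hsum : ∑ j, (d j - 1) = 0) :
    ∫ z, logDensity d z ∂(Measure.pi fun j => gaussianReal 0 (d j).toNNReal) =
      -∑ j, Real.log (d j) / 2 := by
  have hI : ∀ j, Integrable (fun z : ι → ℝ => (1 - 1 / d j) * z j ^ 2 / 2)
      (Measure.pi fun j => gaussianReal 0 (d j).toNNReal) := fun j =>
    ((integrable_sq_eval_pi_gaussianReal _ j).const_mul _).div_const _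
  have hI2 : ∀ j, Integrable (fun z : ι → ℝ =>
      -(Real.log (d j) / 2) + (1 - 1 / d j) * z j ^ 2 / 2)
      (Measure.pi fun j => gaussianReal 0 (d j).toNNReal) := fun j =>
    (integrable_const _).add (hI j)
  simp_rw [logDensity]
  rw [integral_finsetSum _ fun j _ => hI2 j]
  have hterm : ∀ j, ∫ z, (-(Real.log (d j) / 2) + (1 - 1 / d j) * z j ^ 2 / 2)
      ∂(Measure.pi fun j => gaussianReal 0 (d j).toNNReal) =
      -(Real.log (d j) / 2) + (d j - 1) / 2 := by
    intro j
    rw [integral_add (integrable_const _) (hI j), integral_const, integral_div,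
      integral_const_mul, integral_sq_eval_pi_gaussianReal, Real.coe_toNNReal _ (hd j).le]
    have := (hd j).ne'
    simp only [probReal_univ, one_smul]
    field_simp
  simp_rw [hterm]
  rw [Finset.sum_add_distrib, ← Finset.sum_div, hsum, Finset.sum_neg_distrib]
  simp

lemma lintegral_exp_logDensity (hd : ∀ j, 0 < d j) {t : ℝ} (ht : ∀ j, t * (d j - 1) < 1) :
    ∫⁻ z, ENNReal.ofReal (Real.exp (t * logDensity d z))
        ∂(Measure.pi fun j => gaussianReal 0 (d j).toNNReal) =
      ENNReal.ofReal (Real.exp (t * -∑ j, Real.log (d j) / 2) *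
        (√(∏ j, (1 - t * (d j - 1))))⁻¹) := by
  have hexp : ∀ z : ι → ℝ, ENNReal.ofReal (Real.exp (t * logDensity d z)) =
      ∏ j, ENNReal.ofReal (Real.exp (t * -(Real.log (d j) / 2))) *
        ENNReal.ofReal (Real.exp (t * (1 - 1 / d j) / 2 * z j ^ 2)) := by
    intro z
    simp_rw [← ENNReal.ofReal_mul (Real.exp_pos _).le, ← Real.exp_add]
    rw [← ENNReal.ofReal_prod_of_nonneg fun j _ => (Real.exp_pos _).le, ← Real.exp_sum,
      logDensity, Finset.mul_sum]
    congr 3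
    ext1 j
    ring
  simp_rw [hexp]
  rw [lintegral_pi_prod _ (fun j x => ENNReal.ofReal (Real.exp (t * -(Real.log (d j) / 2))) *
        ENNReal.ofReal (Real.exp (t * (1 - 1 / d j) / 2 * x ^ 2))) fun j => by fun_prop]
  have hterm : ∀ j, ∫⁻ x, ENNReal.ofReal (Real.exp (t * -(Real.log (d j) / 2))) *
        ENNReal.ofReal (Real.exp (t * (1 - 1 / d j) / 2 * x ^ 2))
        ∂(gaussianReal 0 (d j).toNNReal) =
      ENNReal.ofReal (Real.exp (t * -(Real.log (d j) / 2)) *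
        (√(1 - t * (d j - 1)))⁻¹) := by
    intro j
    have hdj := hd j
    have hv : 2 * (t * (1 - 1 / d j) / 2) * ((d j).toNNReal : ℝ) = t * (d j - 1) := by
      rw [Real.coe_toNNReal _ hdj.le]
      field_simp
    rw [lintegral_const_mul _ (by fun_prop), lintegral_exp_sq_gaussianReal (by simpa using hdj)
      (by rw [hv]; exact ht j), hv, ENNReal.ofReal_mul (Real.exp_pos _).le]
  simp_rw [hterm]
  rw [← ENNReal.ofReal_prod_of_nonneg fun j _ => by positivity, Finset.prod_mul_distrib,
    ← Real.exp_sum, Finset.prod_inv_distrib,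
    Real.sqrt_prod _ fun j _ => by linarith [ht j], ← Finset.mul_sum, Finset.sum_neg_distrib]

end LogDensity

end GaussianInfo

/-! ### The main theorem. -/

open GaussianInfo in
theorem theorem1 {Ω : Type*} [MeasurableSpace Ω] (P : Measure Ω) [IsProbabilityMeasure P]
    {p q : ℕ} (X : Ω → EuclideanSpace ℝ (Fin p)) (Y : Ω → EuclideanSpace ℝ (Fin q))
    (hXY : HasGaussianLaw (fun ω => (X ω, Y ω)) P)
    (hX : IsUnit (GaussianInfo.covMatrix P X X))
    (hY : IsUnit (GaussianInfo.covMatrix P Y Y))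
    (hac : (P.map fun ω => (X ω, Y ω)) ≪ (P.map X).prod (P.map Y))
    (r : ℕ) (hr : r = (GaussianInfo.covMatrix P X Y).rank) (hr1 : 1 ≤ r)
    (ρ : ℕ → ℝ) (hρ : ρ = GaussianInfo.canonicalCorr P X Y)
    (I : ℝ) (hI : I = GaussianInfo.mutualInfo P X Y) :
    Integrable (GaussianInfo.infoDensity P X Y) P ∧
    (∀ x : ℝ, x ≠ I → Summable fun k => GaussianInfo.pdfTerm r ρ I x k) ∧
    HasPDF (GaussianInfo.infoDensity P X Y) P volume ∧
    (pdf (GaussianInfo.infoDensity P X Y) P volume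
      =ᵐ[volume] fun x => ENNReal.ofReal (GaussianInfo.pdfSeries r ρ I x)) ∧
    (2 ≤ r → ∃ a : (Fin (r - 1) → ℕ) → ℝ,
      (∀ k, Tendsto (fun x => GaussianInfo.pdfTerm r ρ I x k) (𝓝[≠] I) (𝓝 (a k))) ∧
      Summable a ∧
      Tendsto (fun x => GaussianInfo.pdfSeries r ρ I x) (𝓝[≠] I)
        (𝓝 (1 / (ρ (r - 1) * √Real.pi) * ∑' k, a k))) := by
  obtain ⟨hd, Z, hZ, hmapZ, hinfo⟩ := exists_whitening hXY hX hY hac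
  set A := correlationMatrix P X Y with hA
  set d := whitenedVar P X Y with hdef
  have hrank : A.rank = r := by
    have hNx := (sqrt_inv_mul_mul (posSemidef_covMatrix hXY.fst) hX).1
    have hNy := (sqrt_inv_mul_mul (posSemidef_covMatrix hXY.snd) hY).1
    rw [hr, hA, correlationMatrix,
      Matrix.rank_mul_eq_left_of_isUnit_det _ _ ((Matrix.isUnit_iff_isUnit_det _).1 hNy),
      Matrix.rank_mul_eq_right_of_isUnit_det _ _ ((Matrix.isUnit_iff_isUnit_det _).1 hNx)]
  have hρA : ∀ i, ρ i = (Matrix.toEuclideanLin A).singularValues i := fun i => by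
    rw [hρ, canonicalCorr]
  have hanti : Antitone ρ := fun i j hij => by
    rw [hρA, hρA]
    exact LinearMap.singularValues_antitone _ hij
  have hpos : 0 < ρ (r - 1) := by
    rw [hρA, LinearMap.singularValues_pos_iff_lt_finrank_range, ← rank_eq_finrank_range A, hrank]
    omega
  refine ⟨?_, fun x hx => summable_pdfTerm hr1 hpos hanti hx, ?_⟩
  · rw [integrable_congr hinfo]
    have := integrable_logDensity d fun j => (d j).toNNReal
    rw [← hmapZ, integrable_map_measure (measurable_logDensity d).aestronglyMeasurable hZ] at this
    exact this
  have hsum : ∑ j, (d j - 1) = 0 := by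
    simpa [hdef, whitenedVar] using sum_eigenvalues_offDiagBlocks A
  have hI' : I = -∑ j, Real.log (d j) / 2 := by
    rw [hI, mutualInfo, integral_congr_ae hinfo, ← integral_logDensity hd hsum, ← hmapZ,
      integral_map hZ (measurable_logDensity d).aestronglyMeasurable]
  have hprod : ∀ t : ℝ, ∏ j, (1 - t * (d j - 1)) =
      ∏ i ∈ Finset.range r, (1 - ρ i ^ 2 * t ^ 2) := by
    intro t
    have h := prod_one_sub_mul_eigenvalues_offDiagBlocks A t
    rw [hrank] at h
    simpa [hdef, whitenedVar, hρA] using h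
  have hinfo_meas : AEMeasurable (infoDensity P X Y) P :=
    ((measurable_logDensity d).comp_aemeasurable hZ).congr hinfo.symm
  have hlaw : P.map (infoDensity P X Y) =
      (Measure.pi fun j => gaussianReal 0 (d j).toNNReal).map (logDensity d) := by
    rw [Measure.map_congr hinfo, ← hmapZ,
      AEMeasurable.map_map_of_aemeasurable (measurable_logDensity d).aemeasurable hZ]
    rfl
  -- The range of `t` on which the Gaussian integrals and the binomial series are all finite.
  have hsmall : ∀ᶠ t : ℝ in 𝓝 0, (∀ j, t * (d j - 1) < 1) ∧
      ∀ i ∈ Finset.range r, ρ i ^ 2 * t ^ 2 < 1 := by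
    refine Eventually.and (eventually_all.2 fun j => ?_)
      ((Finset.range r).eventually_all.2 fun i _ => ?_)
    · exact (show Continuous fun t : ℝ => t * (d j - 1) by fun_prop).tendsto 0
        |>.eventually_lt_const (by simp)
    · exact (show Continuous fun t : ℝ => ρ i ^ 2 * t ^ 2 by fun_prop).tendsto 0
        |>.eventually_lt_const (by simp)
  obtain ⟨δ, hδ, hsmall⟩ := Metric.eventually_nhds_iff.1 hsmall
  have hmgf : ∀ t, |t| < δ → ∫⁻ x, ENNReal.ofReal (Real.exp (t * x)) ∂P.map (infoDensity P X Y) =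
      ENNReal.ofReal (Real.exp (t * I) * ∏ i ∈ Finset.range r, (√(1 - ρ i ^ 2 * t ^ 2))⁻¹) := by
    intro t ht
    obtain ⟨h1, h2⟩ := hsmall (y := t) (by simpa using ht)
    rw [hlaw, lintegral_map (by fun_prop) (measurable_logDensity d),
      lintegral_exp_logDensity hd h1, ← hI', hprod,
      Real.sqrt_prod _ fun i hi => by linarith [h2 i hi], Finset.prod_inv_distrib]
  have hmix : ∀ t, |t| < δ →
      ∫⁻ x, ENNReal.ofReal (Real.exp (t * x)) ∂volume.withDensity (mixturePDF r ρ I) =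
      ENNReal.ofReal (Real.exp (t * I) * ∏ i ∈ Finset.range r, (√(1 - ρ i ^ 2 * t ^ 2))⁻¹) := by
    intro t ht
    obtain ⟨-, h2⟩ := hsmall (y := t) (by simpa using ht)
    rw [lintegral_withDensity_eq_lintegral_mul _ (measurable_mixturePDF r ρ I) (by fun_prop),
      ← lintegral_exp_mul_mixturePDF hr1 hpos hanti I fun i hi => h2 i (Finset.mem_range.2 hi)]
    simp only [Pi.mul_apply, mul_comm]
  have hfinite : IsFiniteMeasure (volume.withDensity (mixturePDF r ρ I)) := by
    refine ⟨?_⟩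
    -- The transform at `t = 0` is the total mass.
    have h := hmix 0 (by simpa using hδ)
    simp only [zero_mul, Real.exp_zero, ENNReal.ofReal_one, lintegral_const, one_mul] at h
    rw [h]
    exact ENNReal.ofReal_lt_top
  have := Measure.isProbabilityMeasure_map hinfo_meas
  have hdensity : P.map (infoDensity P X Y) = volume.withDensity (mixturePDF r ρ I) :=
    ext_of_lintegral_exp hδ (fun t ht => by rw [hmgf t ht]; exact ENNReal.ofReal_ne_top)
      fun t ht => by rw [hmgf t ht, hmix t ht]
  refine ⟨?_, ?_, fun h2 => ⟨pdfTermLimit r ρ, tendsto_pdfTerm h2 hpos I,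
    summable_pdfTermLimit h2 hpos hanti, tendsto_pdfSeries h2 hpos hanti I⟩⟩
  · rw [hasPDF_iff, hdensity]
    exact ⟨hinfo_meas, inferInstance, withDensity_absolutelyContinuous _ _⟩
  · rw [pdf_def, hdensity]
    refine (Measure.rnDeriv_withDensity _ (measurable_mixturePDF r ρ I)).trans ?_
    -- The series agrees with the mixture only off the null set `{I}`.
    filter_upwards [Measure.ae_ne volume I] with x hx
    exact (ofReal_pdfSeries hr1 hpos hanti hx).symm
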